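/- **Setting.** Let $T>0$, $d\ge 1$, let $S_d\subset\mathbb R^d$ be the simplex of probability vectors with the Euclidean norm, let $(A,\mathbf d)$ be a compact metric space, and for $i,j\in\{1,\dots,d\}$ let $Q_{i,j}:[0,T]\times A\times S_d\to[0,\infty)$, $f^i:[0,T]\times A\times S_d\to\mathbb R$, $g^i:S_d\to\mathbb R$. Put $F(t,a,m)=\sum_i m_i f^i(t,a^i,m)$ for $a=(a^1,\dots,a^d)\in A^d$ and $G(m)=\sum_i m_i g^i(m)$. **Assumption A.** Each $Q_{i,j}$ is continuous, $F$ is continuous on $[0,T]\times A^d\times S_d$, and there is a constant $L$ such that for all $t,s\in[0,T]$, $m,p\in S_d$, all $i,j$ and all actions $a$ (in $A$ for $Q$, in $A^d$ for $F$) $$|Q_{i,j}(t,a,m)-Q_{i,j}(s,a,p)|\le L(|t-s|+|m-p|),\quad |F(t,a,m)-F(s,a,p)|\le L(|t-s|+|m-p|),\quad |G(m)-G(p)|\le L|m-p|.$$ **Mean field control problem.** For $m_0\in S_d$ and a measurable $\alpha:[0,T]\to A^d$ let $\mu:[0,T]\to S_d$ be the absolutely continuous solution of $$\dot\mu^i_t=\sum_j\big(\mu^j_tQ_{j,i}(t,\alpha^j(t),\mu_t)-\mu^i_tQ_{i,j}(t,\alpha^i(t),\mu_t)\big),\qquad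 \mu_0=m_0,$$ and let $J(\alpha)=\int_0^T F(t,\alpha(t),\mu_t)\,dt+G(\mu_T)$. The control $\alpha$ is $\varepsilon$-optimal if $J(\alpha)\le J(\alpha')+\varepsilon$ for every measurable $\alpha':[0,T]\to A^d$. **$N$-agent problem.** For $\bm x\in\{1,\dots,d\}^N$ let $\mu^N_{\bm x}=\frac1N\sum_k\delta_{x_k}$. For feedback controls $\bm\beta=(\beta_1,\dots,\beta_N)$, with $\beta_k(t,\bm x)\in A$ measurable in $t\in[0,T]$, let $\bm X=(X^1,\dots,X^N)$ be the càdlàg Markov chain on $\{1,\dots,d\}^N$ with $X^1_0,\dots,X^N_0$ i.i.d. of law $m_0$ and time-dependent generator (in the sense of the martingale problem) $$\mathcal L_t\phi(\bm x)=\sum_{k=1}^N\sum_{j\ne x_k}Q_{x_k,j}(t,\beta_k(t,\bm x),\mu^N_{\bm x})\,\big[\phi([\bm x^{-k},j])-\phi(\bm x)\big],$$ where $[\bm x^{-k},j]$ is $\bm x$ with $k$-th entry replaced by $j$, and let $$J^N(\bm\beta)=\mathbb E\Big[\int_0^T\frac1N\sum_{k=1}^N f^{X^k_t}\big(t,\beta_k(t,\bm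 X_t),\mu^N_{\bm X_t}\big)\,dt+\frac1N\sum_{k=1}^N g^{X^k_T}(\mu^N_{\bm X_T})\Big].$$ A function $\alpha_N(t,i,m)\in A$, measurable in $t$, of time, own state and empirical measure defines the controls $\beta_k(t,\bm x)=\alpha_N(t,x_k,\mu^N_{\bm x})$, and we write $J^N(\alpha_N)$ for their cost; $J^N(\alpha)$, for $\alpha:[0,T]\to A^d$, is the case $\alpha_N(t,i,m)=\alpha^i(t)$. **Theorem.** Suppose that Assumption A holds. There is a constant $C$, depending only on the data $(T,d,A,Q,f,g)$, such that for all $m_0\in S_d$, $N\ge1$, $\varepsilon>0$ and every $\varepsilon$-optimal control $\alpha$ of the mean field control problem started from $m_0$, $$J^N(\alpha)\le\inf_{\alpha_N}J^N(\alpha_N)+\frac{C}{\sqrt N}+\varepsilon ,$$ the infimum being over all measurable feedbacks $\alpha_N(t,i,m)$; the same bound holds with $\inf_{\bm\beta}J^N(\bm\beta)$, the infimum over all measurable feedback controls $\bm\beta(t,\bm x)$ of time and the states of all agents. -/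

import Mathlib

open MeasureTheory ProbabilityTheory Filter Topology Set

noncomputable section

namespace MFC

/-- The simplex of probability vectors on the `d` states, inside Euclidean space. -/
def simplex (d : ℕ) : Set (EuclideanSpace ℝ (Fin d)) :=
  {m | (∀ i, 0 ≤ m i) ∧ ∑ i, m i = 1}

/-- Empirical measure of a configuration `x` of `N` agents: `i ↦ #{k | x k = i} / N`. -/
def empMeas {d N : ℕ} (x : Fin N → Fin d) : EuclideanSpace ℝ (Fin d) :=
  WithLp.toLp 2 (fun i => (∑ k : Fin N, if x k = i then (1 : ℝ) else 0) / N)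

/-- The data of the control problem: time horizon `T`, transition rates `Q i j t a m`,
running cost `f i t a m` and terminal cost `g i m`. Only the values for `t ∈ [0, T]` and `m` in
the simplex matter; the functions are total merely for convenience. -/
structure Model (d : ℕ) (A : Type*) where
  T : ℝ
  Q : Fin d → Fin d → ℝ → A → EuclideanSpace ℝ (Fin d) → ℝ
  f : Fin d → ℝ → A → EuclideanSpace ℝ (Fin d) → ℝ
  g : Fin d → EuclideanSpace ℝ (Fin d) → ℝ

namespace Model

variable {d : ℕ} {A : Type*}

/-- Aggregated running cost `F(t, a¹, …, aᵈ, m) = ∑ i, mᵢ fⁱ(t, aⁱ, m)`. -/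
def F (D : Model d A) (t : ℝ) (a : Fin d → A) (m : EuclideanSpace ℝ (Fin d)) : ℝ :=
  ∑ i, m i * D.f i t (a i) m

/-- Aggregated terminal cost `G(m) = ∑ i, mᵢ gⁱ(m)`. -/
def G (D : Model d A) (m : EuclideanSpace ℝ (Fin d)) : ℝ :=
  ∑ i, m i * D.g i m

/-- The standing regularity assumptions on the coefficients (the action space being a compact
metric space is expressed by type classes). -/
structure Regular [MetricSpace A] [CompactSpace A] (D : Model d A) : Prop where
  T_pos : 0 < D.T
  Q_nonneg : ∀ i j, ∀ t ∈ Icc 0 D.T, ∀ a, ∀ m ∈ simplex d, 0 ≤ D.Q i j t a m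
  Q_cont : ∀ i j, ContinuousOn
    (fun z : ℝ × A × EuclideanSpace ℝ (Fin d) => D.Q i j z.1 z.2.1 z.2.2)
    (Icc 0 D.T ×ˢ (univ : Set A) ×ˢ simplex d)
  Q_lip : ∃ L : ℝ, ∀ i j, ∀ t ∈ Icc 0 D.T, ∀ s ∈ Icc 0 D.T, ∀ a,
    ∀ m ∈ simplex d, ∀ p ∈ simplex d,
      |D.Q i j t a m - D.Q i j s a p| ≤ L * (|t - s| + ‖m - p‖)
  F_cont : ContinuousOn
    (fun z : ℝ × (Fin d → A) × EuclideanSpace ℝ (Fin d) => D.F z.1 z.2.1 z.2.2)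
    (Icc 0 D.T ×ˢ (univ : Set (Fin d → A)) ×ˢ simplex d)
  F_lip : ∃ L : ℝ, ∀ t ∈ Icc 0 D.T, ∀ s ∈ Icc 0 D.T, ∀ a,
    ∀ m ∈ simplex d, ∀ p ∈ simplex d,
      |D.F t a m - D.F s a p| ≤ L * (|t - s| + ‖m - p‖)
  G_lip : ∃ L : ℝ, ∀ m ∈ simplex d, ∀ p ∈ simplex d, |D.G m - D.G p| ≤ L * ‖m - p‖

/-! ### The mean field control problem -/

/-- `μ` is the flow of laws on `[0, T]` controlled by `α` and started from `m₀`: the absolutely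
continuous (Carathéodory) solution, in integral form, of
`dμⁱ/dt = ∑ j, (μʲ Q_{j,i}(t, αʲ(t), μ) - μⁱ Q_{i,j}(t, αⁱ(t), μ))`, `μ 0 = m₀`. -/
structure IsFlow (D : Model d A) (m₀ : EuclideanSpace ℝ (Fin d)) (α : ℝ → Fin d → A)
    (μ : ℝ → EuclideanSpace ℝ (Fin d)) : Prop where
  mem_simplex : ∀ t ∈ Icc 0 D.T, μ t ∈ simplex d
  cont : ContinuousOn μ (Icc 0 D.T)
  eqn : ∀ t ∈ Icc 0 D.T, ∀ i, μ t i = m₀ i + ∫ s in (0 : ℝ)..t,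
    ∑ j, (μ s j * D.Q j i s (α s j) (μ s) - μ s i * D.Q i j s (α s i) (μ s))

/-- The cost `J(α)` of a control `α` with associated flow `μ`. -/
def mfCost (D : Model d A) (α : ℝ → Fin d → A) (μ : ℝ → EuclideanSpace ℝ (Fin d)) : ℝ :=
  (∫ t in (0 : ℝ)..D.T, D.F t (α t) (μ t)) + D.G (μ D.T)

/-- `α` is an `ε`-optimal open-loop control of the mean field control problem started from `m₀`:
a measurable control whose cost is at most `ε` above the cost of any measurable control. -/
def IsEpsOptimal [MeasurableSpace A] (D : Model d A) (m₀ : EuclideanSpace ℝ (Fin d))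
    (ε : ℝ) (α : ℝ → Fin d → A) : Prop :=
  Measurable α ∧ ∃ μ, D.IsFlow m₀ α μ ∧
    ∀ (α' : ℝ → Fin d → A) (μ' : ℝ → EuclideanSpace ℝ (Fin d)),
      Measurable α' → D.IsFlow m₀ α' μ' → D.mfCost α μ ≤ D.mfCost α' μ' + ε

/-! ### The `N`-agent problem -/

/-- Generator at time `t` of the `N`-agent chain under the feedback controls `β`, where
`β t x k` is the action of agent `k` at time `t` in configuration `x`. -/
def generator {N : ℕ} (D : Model d A) (β : ℝ → (Fin N → Fin d) → Fin N → A) (t : ℝ)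
    (φ : (Fin N → Fin d) → ℝ) (x : Fin N → Fin d) : ℝ :=
  ∑ k, ∑ j ∈ Finset.univ.filter (fun j => j ≠ x k),
    D.Q (x k) j t (β t x k) (empMeas x) * (φ (Function.update x k j) - φ x)

/-- `X` is, under `P`, an `N`-agent controlled Markov chain on `[0, T]` for the feedback
controls `β`: a càdlàg process that solves the martingale problem for the generator above, with
i.i.d. initial states of law `m₀`. -/
structure IsChain {N : ℕ} {Ω : Type*} [MeasurableSpace Ω] (D : Model d A)
    (m₀ : EuclideanSpace ℝ (Fin d)) (β : ℝ → (Fin N → Fin d) → Fin N → A)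
    (P : Measure Ω) (X : ℝ → Ω → Fin N → Fin d) : Prop where
  right_cont : ∀ ω, ∀ t ∈ Ico 0 D.T, ContinuousWithinAt (fun s => X s ω) (Ioi t) t
  left_lim : ∀ ω, ∀ t ∈ Ioc 0 D.T, ∃ y, Tendsto (fun s => X s ω) (𝓝[<] t) (𝓝 y)
  init_indep : iIndepFun (fun (k : Fin N) ω => X 0 ω k) P
  init_law : ∀ k i, P.real {ω | X 0 ω k = i} = m₀ i
  martingale_problem : ∃ ℱ : Filtration (Icc (0 : ℝ) D.T) (inferInstance : MeasurableSpace Ω),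
    (∀ t : Icc (0 : ℝ) D.T, Measurable[ℱ t] (X t)) ∧
    ∀ φ : (Fin N → Fin d) → ℝ,
      Martingale (fun (t : Icc (0 : ℝ) D.T) ω =>
        φ (X t ω) - φ (X 0 ω) - ∫ s in (0 : ℝ)..t, D.generator β s φ (X s ω)) ℱ P

/-- The cost `J^N` of the `N`-agent problem: the average over the agents of the expected running
plus terminal costs. -/
def nCost {N : ℕ} {Ω : Type*} [MeasurableSpace Ω] (D : Model d A)
    (β : ℝ → (Fin N → Fin d) → Fin N → A) (P : Measure Ω) (X : ℝ → Ω → Fin N → Fin d) : ℝ :=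
  ∫ ω, ((∫ t in (0 : ℝ)..D.T,
      (1 / (N : ℝ)) * ∑ k, D.f (X t ω k) t (β t (X t ω) k) (empMeas (X t ω)))
    + (1 / (N : ℝ)) * ∑ k, D.g (X D.T ω k) (empMeas (X D.T ω))) ∂P

end Model

/-- All agents apply the same feedback `αN(t, own state, empirical measure)`. -/
def meanFieldFeedback {d : ℕ} {A : Type*} (N : ℕ)
    (αN : ℝ → Fin d → EuclideanSpace ℝ (Fin d) → A) : ℝ → (Fin N → Fin d) → Fin N → A :=
  fun t x k => αN t (x k) (empMeas x)

/-- All agents apply the control `α(t, own state)`, which ignores the empirical measure. -/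
def decentralized {d : ℕ} {A : Type*} (N : ℕ) (α : ℝ → Fin d → A) :
    ℝ → (Fin N → Fin d) → Fin N → A :=
  meanFieldFeedback N (fun t i _ => α t i)

end MFC

end

noncomputable section

namespace MFC

/-! ### The simplex and empirical measures -/

section Simplex

variable {d : ℕ}

/-! Everything rests on a stability estimate for the controlled flow. If a measurable path in the
simplex satisfies the flow equation of a control up to a defect, Gronwall's inequality bounds the
difference between the cost along the path and the mean field cost of the control by a constant
times the defect at time `T` plus its time integral (`abs_cost_sub_le`). The path need not be
continuous, so it may be the empirical measure of the agents.

Upper bound. Under a decentralized control, the compensator of the empirical measure is exactly the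
drift of the mean field equation, so the defect consists of the initial fluctuation and a
martingale. The initial states are independent, and the carré du champ is of order `1 / N` because
each jump has size `1 / N` and there are `N` agents; hence the defect is of order `1 / √N` in mean
(`integral_noise_le`). This gives `nCost_decentralized_le`.

Lower bound. Under a general feedback, agents in the same state may act differently, so the
empirical measure is driven by a relaxed control, and no convexity is available to replace it by an
ordinary one. Along one fixed trajectory, however, this relaxed control is the uniform mixture of
`N!` ordinary open-loop controls (`average_pick`), and fast periodic switching among them
(`tendsto_integral_switch`) reproduces in the limit both the running cost and the drift. The
trajectory is held fixed while the control oscillates, so only convergence of integrals is needed.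
Each switching control has a flow (`exists_isFlow`), whose cost is at least any lower bound of the
mean field problem; stability followed by the limit yields `le_pathCost`, trajectory by trajectory,
and taking expectations yields `le_nCost`.

Combining the two bounds with `ε`-optimality gives the theorem. -/

lemma abs_apply_le_norm (x : EuclideanSpace ℝ (Fin d)) (i : Fin d) : |x i| ≤ ‖x‖ := by
  simpa using PiLp.norm_apply_le x i

lemma norm_le_sum_abs (x : EuclideanSpace ℝ (Fin d)) : ‖x‖ ≤ ∑ i, |x i| := by
  have h := EuclideanSpace.norm_sq_eq x
  refine abs_le_of_sq_le_sq' ?_ (Finset.sum_nonneg fun i _ => abs_nonneg _) |>.2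
  rw [h]
  simpa using Finset.sum_sq_le_sq_sum_of_nonneg (s := Finset.univ) (f := fun i => |x i|)
    (fun i _ => abs_nonneg _)

lemma apply_le_one_of_mem_simplex {m : EuclideanSpace ℝ (Fin d)} (hm : m ∈ simplex d)
    (i : Fin d) : m i ≤ 1 := by
  rw [← hm.2]
  exact Finset.single_le_sum (fun j _ => hm.1 j) (Finset.mem_univ i)

lemma abs_apply_le_one_of_mem_simplex {m : EuclideanSpace ℝ (Fin d)} (hm : m ∈ simplex d)
    (i : Fin d) : |m i| ≤ 1 := by
  rw [abs_of_nonneg (hm.1 i)]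
  exact apply_le_one_of_mem_simplex hm i

lemma norm_le_one_of_mem_simplex {m : EuclideanSpace ℝ (Fin d)} (hm : m ∈ simplex d) :
    ‖m‖ ≤ 1 := by
  refine (norm_le_sum_abs m).trans ?_
  rw [← hm.2]
  exact Finset.sum_le_sum fun i _ => (abs_of_nonneg (hm.1 i)).le

lemma isClosed_simplex (d : ℕ) : IsClosed (simplex d) := by
  have : simplex d = (⋂ i, {m : EuclideanSpace ℝ (Fin d) | 0 ≤ m i}) ∩ {m | ∑ i, m i = 1} := by
    ext m; simp [simplex]
  rw [this]
  refine (isClosed_iInter fun i => isClosed_le continuous_const ?_).inter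
    (isClosed_eq ?_ continuous_const)
  · fun_prop
  · fun_prop

lemma isCompact_simplex (d : ℕ) : IsCompact (simplex d) :=
  Metric.isCompact_of_isClosed_isBounded (isClosed_simplex d)
    ((Metric.isBounded_closedBall (x := 0) (r := 1)).subset fun m hm => by
      simpa using norm_le_one_of_mem_simplex hm)

lemma empMeas_apply {N : ℕ} (x : Fin N → Fin d) (i : Fin d) :
    empMeas x i = (∑ k : Fin N, if x k = i then (1 : ℝ) else 0) / N := rfl

lemma empMeas_mem_simplex {N : ℕ} (hN : 0 < N) (x : Fin N → Fin d) :
    empMeas x ∈ simplex d := by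
  refine ⟨fun i => ?_, ?_⟩
  · rw [empMeas_apply]
    exact div_nonneg (Finset.sum_nonneg fun k _ => by split_ifs <;> norm_num) N.cast_nonneg
  · simp_rw [empMeas_apply]
    rw [← Finset.sum_div, Finset.sum_comm]
    have : (N : ℝ) ≠ 0 := by positivity
    simp [this]

end Simplex

/-! ### Measurable representatives -/

section Measurability

/-- Composing a function continuous on a measurable set with a measurable map into that set. -/
lemma exists_measurable_eqOn_comp {X Y Z : Type*} [TopologicalSpace X]
    [MeasurableSpace X] [OpensMeasurableSpace X] [TopologicalSpace Y] [MeasurableSpace Y]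
    [BorelSpace Y] [MeasurableSpace Z] [Zero Y] {f : X → Y} {S : Set X} (hf : ContinuousOn f S)
    (hS : MeasurableSet S) {g : Z → X} (hg : Measurable g) {I : Set Z} (hI : MapsTo g I S) :
    ∃ h : Z → Y, Measurable h ∧ EqOn h (f ∘ g) I := by
  classical
  have hm : Measurable (S.piecewise f (fun _ => (0 : Y))) :=
    hf.measurable_piecewise continuousOn_const hS
  exact ⟨_, hm.comp hg, fun z hz => by simp [hI hz]⟩

end Measurability

/-! ### The velocity field: bounds and measurability of the coefficients -/

namespace Model

variable {d : ℕ} {A : Type*}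

/-- The velocity field of the flow of laws. -/
def drift (D : Model d A) (t : ℝ) (a : Fin d → A) (m : EuclideanSpace ℝ (Fin d)) :
    EuclideanSpace ℝ (Fin d) :=
  WithLp.toLp 2 fun i => ∑ j, (m j * D.Q j i t (a j) m - m i * D.Q i j t (a i) m)

lemma drift_apply (D : Model d A) (t : ℝ) (a : Fin d → A) (m : EuclideanSpace ℝ (Fin d))
    (i : Fin d) :
    D.drift t a m i = ∑ j, (m j * D.Q j i t (a j) m - m i * D.Q i j t (a i) m) := rfl

/-- Conservation of mass: inflow and outflow are the same double sum with the indices exchanged. -/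
lemma sum_drift (D : Model d A) (t : ℝ) (a : Fin d → A) (m : EuclideanSpace ℝ (Fin d)) :
    ∑ i, D.drift t a m i = 0 := by
  simp_rw [drift_apply, Finset.sum_sub_distrib]
  rw [Finset.sum_comm, sub_self]

/-- A constant dominating the sizes and the Lipschitz constants (in the measure argument) of all
the coefficients. -/
structure BoundedBy (D : Model d A) (κ : ℝ) : Prop where
  one_le : 1 ≤ κ
  Q_le : ∀ i j, ∀ t ∈ Icc 0 D.T, ∀ a, ∀ m ∈ simplex d, |D.Q i j t a m| ≤ κ
  F_le : ∀ t ∈ Icc 0 D.T, ∀ a, ∀ m ∈ simplex d, |D.F t a m| ≤ κ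
  G_le : ∀ m ∈ simplex d, |D.G m| ≤ κ
  drift_le : ∀ t ∈ Icc 0 D.T, ∀ a, ∀ m ∈ simplex d, ‖D.drift t a m‖ ≤ κ
  drift_lip : ∀ t ∈ Icc 0 D.T, ∀ a, ∀ m ∈ simplex d, ∀ p ∈ simplex d,
    ‖D.drift t a m - D.drift t a p‖ ≤ κ * ‖m - p‖
  F_lip : ∀ t ∈ Icc 0 D.T, ∀ a, ∀ m ∈ simplex d, ∀ p ∈ simplex d,
    |D.F t a m - D.F t a p| ≤ κ * ‖m - p‖
  G_lip : ∀ m ∈ simplex d, ∀ p ∈ simplex d, |D.G m - D.G p| ≤ κ * ‖m - p‖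

lemma drift_bound {D : Model d A} {q : ℝ} {t : ℝ} {a : Fin d → A}
    {m : EuclideanSpace ℝ (Fin d)} (hm : m ∈ simplex d)
    (hq : ∀ i j a, |D.Q i j t a m| ≤ q) : ‖D.drift t a m‖ ≤ d * (d * (q + q)) := by
  refine (norm_le_sum_abs _).trans ?_
  have : ∀ i ∈ Finset.univ, |D.drift t a m i| ≤ d * (q + q) := fun i _ => by
    rw [drift_apply]
    refine (Finset.abs_sum_le_sum_abs _ _).trans ?_
    refine (Finset.sum_le_card_nsmul _ _ (q + q) fun j _ => ?_).trans (by simp [mul_add])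
    have h (i j k : Fin d) : |m k * D.Q i j t (a i) m| ≤ q := by
      rw [abs_mul]
      exact (mul_le_of_le_one_left (abs_nonneg _) (abs_apply_le_one_of_mem_simplex hm k)).trans
        (hq _ _ _)
    exact (abs_sub _ _).trans (add_le_add (h _ _ _) (h _ _ _))
  exact (Finset.sum_le_card_nsmul _ _ _ this).trans (by simp)

lemma drift_lipschitz {D : Model d A} {q L : ℝ} {t : ℝ} {a : Fin d → A}
    {m p : EuclideanSpace ℝ (Fin d)} (hp : p ∈ simplex d)
    (hq : ∀ i j a, |D.Q i j t a m| ≤ q)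
    (hL : ∀ i j a, |D.Q i j t a m - D.Q i j t a p| ≤ L * ‖m - p‖) :
    ‖D.drift t a m - D.drift t a p‖ ≤ d * (d * (2 * (q + L))) * ‖m - p‖ := by
  refine (norm_le_sum_abs _).trans ?_
  have : ∀ i ∈ Finset.univ, |(D.drift t a m - D.drift t a p) i|
      ≤ d * (2 * (q + L) * ‖m - p‖) := fun i _ => by
    rw [PiLp.sub_apply, drift_apply, drift_apply, ← Finset.sum_sub_distrib]
    refine (Finset.abs_sum_le_sum_abs _ _).trans ?_
    refine (Finset.sum_le_card_nsmul _ _ (2 * (q + L) * ‖m - p‖) fun j _ => ?_).trans (by simp)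
    have h (i j k : Fin d) :
        |m k * D.Q i j t (a i) m - p k * D.Q i j t (a i) p| ≤ (q + L) * ‖m - p‖ := by
      have e : m k * D.Q i j t (a i) m - p k * D.Q i j t (a i) p
          = (m - p) k * D.Q i j t (a i) m + p k * (D.Q i j t (a i) m - D.Q i j t (a i) p) := by
        rw [PiLp.sub_apply]; ring
      rw [e]
      refine (abs_add_le _ _).trans ?_
      rw [abs_mul, abs_mul, add_mul, mul_comm q]
      refine add_le_add (mul_le_mul (abs_apply_le_norm _ _) (hq _ _ _) (abs_nonneg _)
        (norm_nonneg _)) ?_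
      exact (mul_le_of_le_one_left (abs_nonneg _) (abs_apply_le_one_of_mem_simplex hp k)).trans
        (hL _ _ _)
    have e : m j * D.Q j i t (a j) m - m i * D.Q i j t (a i) m
        - (p j * D.Q j i t (a j) p - p i * D.Q i j t (a i) p)
        = (m j * D.Q j i t (a j) m - p j * D.Q j i t (a j) p)
          - (m i * D.Q i j t (a i) m - p i * D.Q i j t (a i) p) := by ring
    rw [e]
    exact (abs_sub _ _).trans ((add_le_add (h _ _ _) (h _ _ _)).trans (by linarith))
  exact (Finset.sum_le_card_nsmul _ _ _ this).trans (by simp [mul_assoc])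

variable [MetricSpace A] [CompactSpace A]

/-- Compactness of `[0, T] × A × simplex` provides the bounds. The Lipschitz constants in the
assumptions carry no sign, so their absolute values enter `κ`. -/
lemma Regular.exists_boundedBy {D : Model d A} (hD : D.Regular) : ∃ κ, D.BoundedBy κ := by
  have hT : (0 : ℝ) ∈ Icc 0 D.T := ⟨le_rfl, hD.T_pos.le⟩
  have hQ : ∀ i j, ∃ C, ∀ t ∈ Icc 0 D.T, ∀ a, ∀ m ∈ simplex d, |D.Q i j t a m| ≤ C := by
    intro i j
    obtain ⟨C, hC⟩ := (isCompact_Icc.prod (isCompact_univ.prod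
      (isCompact_simplex d))).exists_bound_of_continuousOn (hD.Q_cont i j)
    exact ⟨C, fun t ht a m hm => hC (t, a, m) ⟨ht, mem_univ _, hm⟩⟩
  choose q hq using hQ
  obtain ⟨c, hc⟩ := (isCompact_Icc.prod (isCompact_univ.prod
      (isCompact_simplex d))).exists_bound_of_continuousOn hD.F_cont
  obtain ⟨L₁, hL₁⟩ := hD.Q_lip
  obtain ⟨L₂, hL₂⟩ := hD.F_lip
  obtain ⟨L₃, hL₃⟩ := hD.G_lip
  have hGc : ContinuousOn D.G (simplex d) := by
    refine LipschitzOnWith.continuousOn (K := (|L₃|).toNNReal) (.of_dist_le_mul fun m hm p hp => ?_)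
    rw [Real.dist_eq, dist_eq_norm, Real.coe_toNNReal _ (abs_nonneg _)]
    exact (hL₃ m hm p hp).trans (mul_le_mul_of_nonneg_right (le_abs_self _) (norm_nonneg _))
  obtain ⟨c', hc'⟩ := (isCompact_simplex d).exists_bound_of_continuousOn hGc
  set q' : ℝ := ∑ i, ∑ j, |q i j| with hq'
  have hq'0 : 0 ≤ q' := Finset.sum_nonneg fun i _ => Finset.sum_nonneg fun j _ => abs_nonneg _
  have hQ' : ∀ i j, ∀ t ∈ Icc 0 D.T, ∀ a, ∀ m ∈ simplex d, |D.Q i j t a m| ≤ q' := by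
    intro i j t ht a m hm
    refine ((hq i j t ht a m hm).trans (le_abs_self _)).trans ?_
    refine (Finset.single_le_sum (f := fun j => |q i j|) (fun j _ => abs_nonneg _)
      (Finset.mem_univ j)).trans ?_
    exact Finset.single_le_sum (f := fun i => ∑ j, |q i j|)
      (fun i _ => Finset.sum_nonneg fun j _ => abs_nonneg _) (Finset.mem_univ i)
  set k₁ : ℝ := d * (d * (q' + q'))
  set k₂ : ℝ := d * (d * (2 * (q' + |L₁|)))
  have hk₁ : 0 ≤ k₁ := by positivity
  have hk₂ : 0 ≤ k₂ := by positivity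
  have lip : ∀ {u L : ℝ}, 0 ≤ u → L * u ≤ |L| * u := fun hu =>
    mul_le_mul_of_nonneg_right (le_abs_self _) hu
  set κ : ℝ := 1 + q' + |c| + |c'| + k₁ + k₂ + |L₂| + |L₃| with hκ
  have a₁ := abs_nonneg c
  have a₂ := abs_nonneg c'
  have a₃ := abs_nonneg L₂
  have a₄ := abs_nonneg L₃
  refine ⟨κ, by linarith, fun i j t ht a m hm => (hQ' i j t ht a m hm).trans (by linarith),
    fun t ht a m hm => ?_, fun m hm => ?_, fun t ht a m hm => ?_, fun t ht a m hm p hp => ?_,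
    fun t ht a m hm p hp => ?_, fun m hm p hp => ?_⟩
  · exact ((hc (t, a, m) ⟨ht, mem_univ _, hm⟩).trans (le_abs_self _)).trans (by linarith)
  · exact ((hc' m hm).trans (le_abs_self _)).trans (by linarith)
  · exact (drift_bound hm fun i j a => hQ' i j t ht a m hm).trans (by linarith)
  · refine (drift_lipschitz (L := |L₁|) hp (fun i j a => hQ' i j t ht a m hm)
      fun i j a => ?_).trans
      (mul_le_mul_of_nonneg_right (by linarith) (norm_nonneg _))
    refine (hL₁ i j t ht t ht a m hm p hp).trans ?_
    rw [sub_self, abs_zero, zero_add]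
    exact lip (norm_nonneg _)
  · refine (hL₂ t ht t ht a m hm p hp).trans ?_
    rw [sub_self, abs_zero, zero_add]
    exact (lip (norm_nonneg _)).trans (mul_le_mul_of_nonneg_right (by linarith) (norm_nonneg _))
  · exact (hL₃ m hm p hp).trans ((lip (norm_nonneg _)).trans
      (mul_le_mul_of_nonneg_right (by linarith) (norm_nonneg _)))

variable [MeasurableSpace A] [BorelSpace A]

/-- Nothing is known about the coefficients off `[0, T]` and the simplex, where they may fail to be
measurable. A measurable function agreeing with them on the relevant set is all that integrability
requires. -/
lemma Regular.exists_measurable_Q {Z : Type*} [MeasurableSpace Z] {D : Model d A}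
    (hD : D.Regular) (i j : Fin d) {τ : Z → ℝ} (hτ : Measurable τ) {a : Z → A}
    (ha : Measurable a) {m : Z → EuclideanSpace ℝ (Fin d)} (hm : Measurable m) {I : Set Z}
    (hτI : ∀ z ∈ I, τ z ∈ Icc 0 D.T) (hmI : ∀ z ∈ I, m z ∈ simplex d) :
    ∃ h : Z → ℝ, Measurable h ∧ ∀ z ∈ I, h z = D.Q i j (τ z) (a z) (m z) :=
  exists_measurable_eqOn_comp (hD.Q_cont i j)
    (measurableSet_Icc.prod (MeasurableSet.univ.prod (isClosed_simplex d).measurableSet))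
    (hτ.prodMk (ha.prodMk hm)) (fun z hz => ⟨hτI z hz, mem_univ _, hmI z hz⟩)

lemma Regular.exists_measurable_F {Z : Type*} [MeasurableSpace Z] {D : Model d A}
    (hD : D.Regular) {τ : Z → ℝ} (hτ : Measurable τ) {a : Z → Fin d → A}
    (ha : Measurable a) {m : Z → EuclideanSpace ℝ (Fin d)} (hm : Measurable m) {I : Set Z}
    (hτI : ∀ z ∈ I, τ z ∈ Icc 0 D.T) (hmI : ∀ z ∈ I, m z ∈ simplex d) :
    ∃ h : Z → ℝ, Measurable h ∧ ∀ z ∈ I, h z = D.F (τ z) (a z) (m z) :=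
  exists_measurable_eqOn_comp hD.F_cont
    (measurableSet_Icc.prod (MeasurableSet.univ.prod (isClosed_simplex d).measurableSet))
    (hτ.prodMk (ha.prodMk hm)) (fun z hz => ⟨hτI z hz, mem_univ _, hmI z hz⟩)

lemma Regular.exists_measurable_drift {Z : Type*} [MeasurableSpace Z] {D : Model d A}
    (hD : D.Regular) {τ : Z → ℝ} (hτ : Measurable τ) {a : Z → Fin d → A}
    (ha : Measurable a) {m : Z → EuclideanSpace ℝ (Fin d)} (hm : Measurable m) {I : Set Z}
    (hτI : ∀ z ∈ I, τ z ∈ Icc 0 D.T) (hmI : ∀ z ∈ I, m z ∈ simplex d) :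
    ∃ h : Z → EuclideanSpace ℝ (Fin d), Measurable h ∧
      ∀ z ∈ I, h z = D.drift (τ z) (a z) (m z) := by
  have H (i j : Fin d) := hD.exists_measurable_Q i j hτ (a := fun z => a z i)
    (measurable_pi_apply i |>.comp ha) hm hτI hmI
  choose h hh hI using H
  have hm' (i : Fin d) : Measurable fun z => m z i := by
    have : Measurable fun x : EuclideanSpace ℝ (Fin d) => x i := by fun_prop
    exact this.comp hm
  refine ⟨fun z => WithLp.toLp 2 fun i => ∑ j, (m z j * h j i z - m z i * h i j z), ?_,
    fun z hz => ?_⟩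
  · refine (WithLp.measurable_toLp 2 _).comp (measurable_pi_lambda _ fun i => ?_)
    exact Finset.measurable_sum _ fun j _ => ((hm' j).mul (hh j i)).sub ((hm' i).mul (hh i j))
  · ext i
    simp only [drift_apply, hI _ _ z hz]

end Model

/-! ### Integration by parts, Gronwall, fast periodic switching -/

section RealAnalysis

/-- Integration by parts for primitives of integrable functions. -/
lemma integral_mul_primitive_add {φ ψ : ℝ → ℝ} {t : ℝ} (hφ : IntervalIntegrable φ volume 0 t)
    (hψ : IntervalIntegrable ψ volume 0 t) :
    ∫ s in (0 : ℝ)..t, (φ s * (∫ r in (0 : ℝ)..s, ψ r) + (∫ r in (0 : ℝ)..s, φ r) * ψ s)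
      = (∫ s in (0 : ℝ)..t, φ s) * ∫ s in (0 : ℝ)..t, ψ s := by
  have h := (hφ.absolutelyContinuousOnInterval_intervalIntegral
    (c := 0) left_mem_uIcc).integral_deriv_mul_eq_sub
      (hψ.absolutelyContinuousOnInterval_intervalIntegral (c := 0) left_mem_uIcc)
  simp only [intervalIntegral.integral_same, mul_zero, sub_zero] at h
  rw [← h]
  refine intervalIntegral.integral_congr_ae ?_
  filter_upwards [hφ.ae_hasDerivAt_integral, hψ.ae_hasDerivAt_integral] with s h₁ h₂ hs
  have hs' := uIoc_subset_uIcc hs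
  rw [(h₁ hs' 0 left_mem_uIcc).deriv, (h₂ hs' 0 left_mem_uIcc).deriv]

/-- Gronwall's inequality in integral form. -/
lemma le_exp_of_le_integral {w : ℝ → ℝ} (hw : Continuous w) {c K T : ℝ} (hK : 0 < K)
    (hw0 : ∀ t, 0 ≤ w t) (h : ∀ t ∈ Icc 0 T, w t ≤ c + K * ∫ s in (0 : ℝ)..t, w s) :
    ∀ t ∈ Icc 0 T, w t ≤ c * Real.exp (K * t) := by
  intro t ht
  have hder : ∀ x, HasDerivAt (fun t => ∫ s in (0 : ℝ)..t, w s) (w x) x := fun x =>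
    intervalIntegral.integral_hasDerivAt_right (hw.intervalIntegrable _ _)
      (hw.stronglyMeasurableAtFilter _ _) hw.continuousAt
  -- The differential form of Gronwall is applied to the primitive of `w`, since `w` itself need not
  -- be differentiable.
  have hb := norm_le_gronwallBound_of_norm_deriv_right_le
    (f := fun t => ∫ s in (0 : ℝ)..t, w s) (f' := w) (δ := 0) (K := K) (ε := c) (a := 0) (b := T)
    (fun x _ => (hder x).continuousAt.continuousWithinAt) (fun x _ => (hder x).hasDerivWithinAt)
    (by simp) (fun x hx => by
      have hx0 : 0 ≤ ∫ s in (0 : ℝ)..x, w s :=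
        intervalIntegral.integral_nonneg hx.1 fun s _ => hw0 s
      rw [Real.norm_of_nonneg (hw0 x), Real.norm_of_nonneg hx0]
      linarith [h x ⟨hx.1, hx.2.le⟩]) t ht
  rw [gronwallBound_of_K_ne_0 hK.ne', sub_zero] at hb
  have h1 := (le_abs_self _).trans hb
  refine (h t ht).trans ((add_le_add_right (mul_le_mul_of_nonneg_left h1 hK.le) c).trans_eq ?_)
  field_simp
  ring

/-- Translations act continuously on integrable functions. -/
lemma tendsto_integral_norm_translate_sub {f : ℝ → ℝ} (hf : Integrable f) :
    Tendsto (fun h : ℝ => ∫ s, ‖f (s + h) - f s‖) (𝓝 0) (𝓝 0) := by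
  have hcomp : ∀ {u : ℝ → ℝ}, Integrable u → ∀ h, Integrable fun s => ‖u (s + h) - u s‖ :=
    fun hu h => ((hu.comp_add_right h).sub hu).norm
  -- Compactly supported continuous functions are handled by dominated convergence; density in `L¹`
  -- and translation invariance give the general case.
  have key : ∀ g : ℝ → ℝ, HasCompactSupport g → Continuous g →
      Tendsto (fun h : ℝ => ∫ s, ‖g (s + h) - g s‖) (𝓝 0) (𝓝 0) := by
    intro g hgs hgc
    obtain ⟨C, hC⟩ := hgs.exists_bound_of_continuous hgc
    obtain ⟨R, hR⟩ := hgs.isCompact.isBounded.subset_closedBall 0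
    have hz : ∀ s, R < |s| → g s = 0 := fun s hs => by
      by_contra hne
      have := hR (subset_tsupport g (Function.mem_support.2 hne))
      simp only [Metric.mem_closedBall, dist_zero_right, Real.norm_eq_abs] at this
      linarith
    have hz0 : (0 : ℝ) = ∫ s : ℝ, ‖g (s + 0) - g s‖ := by simp
    nth_rewrite 2 [hz0]
    refine tendsto_integral_filter_of_dominated_convergence
      ((Icc (-(R + 1)) (R + 1)).indicator fun _ => C + C) ?_ ?_ ?_ ?_
    · exact Eventually.of_forall fun h => by
        have : Continuous fun s => ‖g (s + h) - g s‖ := by fun_prop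
        exact this.aestronglyMeasurable
    · filter_upwards [Metric.ball_mem_nhds (0 : ℝ) one_pos] with h hh
      refine Eventually.of_forall fun s => ?_
      rw [norm_norm]
      simp only [Metric.mem_ball, dist_zero_right, Real.norm_eq_abs] at hh
      by_cases hs : s ∈ Icc (-(R + 1)) (R + 1)
      · rw [indicator_of_mem hs]
        exact (norm_sub_le _ _).trans (add_le_add (hC _) (hC _))
      · rw [indicator_of_notMem hs]
        have h1 : R + 1 < |s| := by
          by_contra hle
          exact hs (abs_le.1 (not_lt.1 hle))
        have h2 : |s| ≤ |s + h| + |h| := by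
          have := abs_sub (s + h) h
          simpa using this
        rw [hz s (by linarith), hz (s + h) (by linarith)]
        simp
    · exact (integrable_indicator_iff measurableSet_Icc).2 (by simp)
    · refine Eventually.of_forall fun s => ?_
      have : Continuous fun h => ‖g (s + h) - g s‖ := by fun_prop
      exact this.tendsto 0
  rw [Metric.tendsto_nhds]
  intro ε hε
  obtain ⟨g, hgs, hfg, hgc, hgi⟩ :=
    hf.exists_hasCompactSupport_integral_sub_le (show 0 < ε / 4 by positivity)
  filter_upwards [(Metric.tendsto_nhds.1 (key g hgs hgc)) (ε / 2) (by positivity)] with h hh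
  have nn : ∀ {u : ℝ → ℝ}, 0 ≤ ∫ s, ‖u s‖ := integral_nonneg fun _ => norm_nonneg _
  rw [Real.dist_0_eq_abs, abs_of_nonneg nn] at hh ⊢
  have hsub : Integrable fun s => ‖f s - g s‖ := (hf.sub hgi).norm
  have e : ∫ s, ‖f (s + h) - g (s + h)‖ = ∫ s, ‖f s - g s‖ :=
    integral_add_right_eq_self (fun s => ‖f s - g s‖) h
  have hle : ∫ s, ‖f (s + h) - f s‖
      ≤ ∫ s, (‖f (s + h) - g (s + h)‖ + ‖g (s + h) - g s‖ + ‖f s - g s‖) := by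
    refine integral_mono (hcomp hf h) (((hsub.comp_add_right h).add (hcomp hgi h)).add hsub)
      fun s => ?_
    calc ‖f (s + h) - f s‖
        = ‖(f (s + h) - g (s + h)) + (g (s + h) - g s) - (f s - g s)‖ := by congr 1; ring
      _ ≤ _ := (norm_sub_le _ _).trans (add_le_add_left (norm_add_le _ _) _)
  have i₁ : Integrable fun s => ‖f (s + h) - g (s + h)‖ := hsub.comp_add_right h
  have i₂ : Integrable fun s => ‖f (s + h) - g (s + h)‖ + ‖g (s + h) - g s‖ :=
    i₁.add (hcomp hgi h)
  rw [integral_add i₂ hsub, integral_add i₁ (hcomp hgi h), e] at hle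
  linarith

/-- The index, in `{0, …, K - 1}`, of a periodic switching of frequency `n`. -/
def switch (K n : ℕ) (s : ℝ) : ℕ := (⌊(n : ℝ) * s⌋ % (K : ℤ)).toNat

lemma measurable_switch (K n : ℕ) : Measurable (switch K n) := by
  have h1 : Measurable fun s : ℝ => ⌊(n : ℝ) * s⌋ := by fun_prop
  exact (measurable_from_top (f := fun z : ℤ => (z % (K : ℤ)).toNat)).comp h1

lemma switch_lt {K : ℕ} (hK : 0 < K) (n : ℕ) (s : ℝ) : switch K n s < K := by
  have := Int.emod_lt_of_pos ⌊(n : ℝ) * s⌋ (by exact_mod_cast hK : (0 : ℤ) < K)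
  have h0 := Int.emod_nonneg ⌊(n : ℝ) * s⌋ (by exact_mod_cast hK.ne' : (K : ℤ) ≠ 0)
  unfold switch
  omega

/-- A shift by `l / n` adds `l` to `⌊n s⌋`. Thus the set where index `l` is active is a translate,
by a vanishing amount, of the set where index `0` is active. -/
lemma switch_translate {K n l : ℕ} (hn : 0 < n) (hl : l < K) (s : ℝ) :
    switch K n (s + l / n) = l ↔ switch K n s = 0 := by
  have hn' : (n : ℝ) ≠ 0 := by positivity
  have hK : (0 : ℤ) < K := by exact_mod_cast (Nat.zero_le l).trans_lt hl
  have e : (n : ℝ) * (s + l / n) = n * s + (l : ℕ) := by field_simp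
  unfold switch
  rw [e, Int.floor_add_natCast]
  set z := ⌊(n : ℝ) * s⌋
  have h1 := Int.emod_nonneg (z + l) hK.ne'
  have h2 := Int.emod_nonneg z hK.ne'
  have h3 := Int.emod_lt_of_pos z hK
  have key : (z + l) % (K : ℤ) = l ↔ z % (K : ℤ) = 0 := by
    have hlK : (l : ℤ) % K = l := Int.emod_eq_of_lt (by omega) (by omega)
    conv_lhs => rhs; rw [← hlK]
    rw [Int.emod_eq_emod_iff_emod_sub_eq_zero]
    simp
  omega

/-- Along a fast periodic switching, the integral of the selected function tends to that of the
average. -/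
lemma tendsto_integral_switch {K : ℕ} (hK : 0 < K) {v : ℕ → ℝ → ℝ} (hv : ∀ l, Integrable (v l)) :
    Tendsto (fun n : ℕ => ∫ s, v (switch K n s) s) atTop
      (𝓝 ((1 / (K : ℝ)) * ∑ l ∈ Finset.range K, ∫ s, v l s)) := by
  have hK' : (K : ℝ) ≠ 0 := by positivity
  have hB : ∀ n l, MeasurableSet {s | switch K n s = l} := fun n l =>
    measurable_switch K n (measurableSet_singleton l)
  have hind : ∀ {f : ℝ → ℝ}, Integrable f → ∀ n l,
      Integrable ({s | switch K n s = l}.indicator f) := fun hf n l => hf.indicator (hB n l)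
  have hsum : ∀ (w : ℕ → ℝ → ℝ) n s, w (switch K n s) s
      = ∑ l ∈ Finset.range K, {s | switch K n s = l}.indicator (w l) s := fun w n s => by
    rw [Finset.sum_eq_single (switch K n s)]
    · simp
    · intro l _ hl
      exact indicator_of_notMem (fun h => hl h.symm) _
    · intro h
      exact absurd (Finset.mem_range.2 (switch_lt hK n s)) h
  -- After a change of variables, the integrals over the two active sets differ by at most the `L¹`
  -- distance from `f` to its translate.
  have hdiff : ∀ {f : ℝ → ℝ}, Integrable f → ∀ l < K,
      Tendsto (fun n : ℕ => (∫ s, {s | switch K n s = l}.indicator f s)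
        - ∫ s, {s | switch K n s = 0}.indicator f s) atTop (𝓝 0) := by
    intro f hf l hl
    have ht : Tendsto (fun n : ℕ => (l : ℝ) / n) atTop (𝓝 0) :=
      tendsto_const_div_atTop_nhds_zero_nat _
    refine squeeze_zero_norm' ?_ ((tendsto_integral_norm_translate_sub hf).comp ht)
    filter_upwards [eventually_gt_atTop 0] with n hn
    rw [← integral_add_right_eq_self _ ((l : ℝ) / n), ← integral_sub
      ((hind hf n l).comp_add_right _) (hind hf n 0)]
    refine norm_integral_le_of_norm_le ((hf.comp_add_right _).sub hf).norm
      (Eventually.of_forall fun s => ?_)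
    by_cases h : switch K n s = 0
    · rw [indicator_of_mem (show s ∈ {s | switch K n s = 0} from h),
        indicator_of_mem (show s + (l : ℝ) / n ∈ {s | switch K n s = l} from
          (switch_translate hn hl s).2 h)]
    · rw [indicator_of_notMem (show s ∉ {s | switch K n s = 0} from h),
        indicator_of_notMem (show s + (l : ℝ) / n ∉ {s | switch K n s = l} from
          fun h' => h ((switch_translate hn hl s).1 h'))]
      simp
  -- The `K` pieces are asymptotically equal and add up to the full integral, so each carries the
  -- fraction `1 / K`.
  have hone : ∀ {f : ℝ → ℝ}, Integrable f → ∀ l < K,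
      Tendsto (fun n : ℕ => ∫ s, {s | switch K n s = l}.indicator f s) atTop
        (𝓝 ((1 / (K : ℝ)) * ∫ s, f s)) := by
    intro f hf l hl
    have h0 : Tendsto (fun n : ℕ => (1 / (K : ℝ)) * ((∫ s, f s) - ∑ j ∈ Finset.range K,
        ((∫ s, {s | switch K n s = j}.indicator f s)
          - ∫ s, {s | switch K n s = 0}.indicator f s))) atTop
        (𝓝 ((1 / (K : ℝ)) * ((∫ s, f s) - ∑ j ∈ Finset.range K, 0))) :=
      ((tendsto_const_nhds).sub (tendsto_finsetSum _ fun j hj =>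
        hdiff hf j (Finset.mem_range.1 hj))).const_mul _
    have h1 := h0.add (hdiff hf l hl)
    simp only [Finset.sum_const_zero, sub_zero, add_zero] at h1
    refine h1.congr fun n => ?_
    have h2 : ∫ s, f s = ∑ j ∈ Finset.range K, ∫ s, {s | switch K n s = j}.indicator f s := by
      rw [← integral_finsetSum _ fun j _ => hind hf n j]
      exact integral_congr_ae (Eventually.of_forall fun s => hsum (fun _ => f) n s)
    rw [Finset.sum_sub_distrib, ← h2]
    simp only [Finset.sum_const, Finset.card_range, nsmul_eq_mul]
    field_simp
    ring
  have : ∀ n : ℕ, ∫ s, v (switch K n s) s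
      = ∑ l ∈ Finset.range K, ∫ s, {s | switch K n s = l}.indicator (v l) s := fun n => by
    rw [← integral_finsetSum _ fun l _ => hind (hv l) n l]
    exact integral_congr_ae (Eventually.of_forall fun s => hsum v n s)
  simp_rw [this, Finset.mul_sum]
  exact tendsto_finsetSum _ fun l hl => hone (hv l) l (Finset.mem_range.1 hl)

end RealAnalysis

lemma intervalIntegral_apply {d : ℕ} {g : ℝ → EuclideanSpace ℝ (Fin d)} {a b : ℝ}
    (hg : IntervalIntegrable g volume a b) (i : Fin d) :
    (∫ s in a..b, g s) i = ∫ s in a..b, g s i :=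
  ((EuclideanSpace.proj (𝕜 := ℝ) i).intervalIntegral_comp_comm hg).symm

lemma intervalIntegrable_apply {d : ℕ} {g : ℝ → EuclideanSpace ℝ (Fin d)} {a b : ℝ}
    (hg : IntervalIntegrable g volume a b) (i : Fin d) :
    IntervalIntegrable (fun s => g s i) volume a b :=
  ⟨(EuclideanSpace.proj (𝕜 := ℝ) i).integrable_comp hg.1,
    (EuclideanSpace.proj (𝕜 := ℝ) i).integrable_comp hg.2⟩

lemma intervalIntegrable_of_bounded {E : Type*} [NormedAddCommGroup E] [MeasurableSpace E]
    [BorelSpace E] [SecondCountableTopology E] {f h : ℝ → E} {T C : ℝ}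
    (hh : Measurable h) (hf : ∀ t ∈ Icc 0 T, h t = f t) (hC : ∀ t ∈ Icc 0 T, ‖f t‖ ≤ C)
    {t : ℝ} (ht : t ∈ Icc 0 T) : IntervalIntegrable f volume 0 t := by
  rw [intervalIntegrable_iff_integrableOn_Icc_of_le ht.1]
  have hsub : Icc 0 t ⊆ Icc 0 T := Icc_subset_Icc_right ht.2
  have : IntegrableOn h (Icc 0 t) :=
    Measure.integrableOn_of_bounded (M := C) (by simp) hh.aestronglyMeasurable
      ((ae_restrict_iff' measurableSet_Icc).2 (Eventually.of_forall fun s hs => by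
        rw [hf s (hsub hs)]; exact hC s (hsub hs)))
  exact this.congr_fun (fun s hs => hf s (hsub hs)) measurableSet_Icc

/-! ### Existence of the flow by a simplex-preserving Picard iteration -/

namespace Model

variable {d : ℕ} {A : Type*} {D : Model d A}

section

variable [MetricSpace A] [CompactSpace A] [MeasurableSpace A] [BorelSpace A]

lemma Regular.intervalIntegrable_drift (hD : D.Regular) {κ : ℝ} (hκ : D.BoundedBy κ)
    {a : ℝ → Fin d → A} (ha : Measurable a) {m : ℝ → EuclideanSpace ℝ (Fin d)}
    (hm : Measurable m) (hmS : ∀ t ∈ Icc 0 D.T, m t ∈ simplex d) {t : ℝ} (ht : t ∈ Icc 0 D.T) :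
    IntervalIntegrable (fun s => D.drift s (a s) (m s)) volume 0 t := by
  obtain ⟨h, hh, hhI⟩ := hD.exists_measurable_drift measurable_id ha hm (I := Icc 0 D.T)
    (fun _ h => h) hmS
  exact intervalIntegrable_of_bounded hh hhI
    (fun s hs => hκ.drift_le s hs _ _ (hmS s hs)) ht

lemma Regular.intervalIntegrable_F (hD : D.Regular) {κ : ℝ} (hκ : D.BoundedBy κ)
    {a : ℝ → Fin d → A} (ha : Measurable a) {m : ℝ → EuclideanSpace ℝ (Fin d)}
    (hm : Measurable m) (hmS : ∀ t ∈ Icc 0 D.T, m t ∈ simplex d) {t : ℝ} (ht : t ∈ Icc 0 D.T) :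
    IntervalIntegrable (fun s => D.F s (a s) (m s)) volume 0 t := by
  obtain ⟨h, hh, hhI⟩ := hD.exists_measurable_F measurable_id ha hm (I := Icc 0 D.T)
    (fun _ h => h) hmS
  exact intervalIntegrable_of_bounded hh hhI
    (fun s hs => hκ.F_le s hs _ _ (hmS s hs)) ht

end

/-- The transition probabilities of the uniformized chain, applied to `m`. -/
def jumpMeas (D : Model d A) (Λ t : ℝ) (a : Fin d → A) (m : EuclideanSpace ℝ (Fin d)) :
    EuclideanSpace ℝ (Fin d) := m + Λ⁻¹ • D.drift t a m

/-- The outflow from state `i` is at most `d κ mᵢ ≤ Λ mᵢ`, so a step of length `1 / Λ` along the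
drift cannot make a coordinate negative; mass is conserved by `sum_drift`. -/
lemma jumpMeas_mem_simplex {κ Λ : ℝ} (hΛ : 0 < Λ) (hκΛ : d * κ ≤ Λ) {t : ℝ}
    {a : Fin d → A} {m : EuclideanSpace ℝ (Fin d)} (hm : m ∈ simplex d)
    (h0 : ∀ i j a, 0 ≤ D.Q i j t a m) (hκ : ∀ i j a, D.Q i j t a m ≤ κ) :
    D.jumpMeas Λ t a m ∈ simplex d := by
  refine ⟨fun i => ?_, ?_⟩
  · have hd : -(Λ * m i) ≤ D.drift t a m i := by
      rw [drift_apply, Finset.sum_sub_distrib, ← Finset.mul_sum]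
      have h1 : 0 ≤ ∑ j, m j * D.Q j i t (a j) m :=
        Finset.sum_nonneg fun j _ => mul_nonneg (hm.1 j) (h0 _ _ _)
      have h2 : ∑ j, D.Q i j t (a i) m ≤ d * κ :=
        (Finset.sum_le_card_nsmul _ _ κ fun j _ => hκ _ _ _).trans (by simp)
      have h3 := mul_le_mul_of_nonneg_left (h2.trans hκΛ) (hm.1 i)
      linarith
    have : D.jumpMeas Λ t a m i = Λ⁻¹ * (Λ * m i + D.drift t a m i) := by
      simp only [jumpMeas, PiLp.add_apply, PiLp.smul_apply, smul_eq_mul]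
      field_simp
    rw [this]
    exact mul_nonneg (inv_nonneg.2 hΛ.le) (by linarith)
  · simp only [jumpMeas, PiLp.add_apply, PiLp.smul_apply, smul_eq_mul, Finset.sum_add_distrib,
      ← Finset.mul_sum, sum_drift, mul_zero, add_zero]
    exact hm.2

section Existence

/-- Paths in the simplex over `[0, T]`. -/
abbrev SimplexPath (D : Model d A) : Type := C(Icc (0 : ℝ) D.T, simplex d)

/-- Extension of a path to the real line, constant outside `[0, T]`. -/
def SimplexPath.ext (hT : 0 ≤ D.T) (μ : D.SimplexPath) (s : ℝ) : EuclideanSpace ℝ (Fin d) :=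
  μ (projIcc 0 D.T hT s)

lemma SimplexPath.continuous_ext (hT : 0 ≤ D.T) (μ : D.SimplexPath) :
    Continuous (μ.ext hT) :=
  continuous_subtype_val.comp (μ.continuous.comp continuous_projIcc)

lemma SimplexPath.ext_mem (hT : 0 ≤ D.T) (μ : D.SimplexPath) (s : ℝ) :
    μ.ext hT s ∈ simplex d := (μ (projIcc 0 D.T hT s)).2

lemma integral_exp_mul (Λ t : ℝ) :
    ∫ s in (0 : ℝ)..t, Λ * Real.exp (Λ * s) = Real.exp (Λ * t) - 1 := by
  simp

variable [MetricSpace A] [CompactSpace A] [MeasurableSpace A] [BorelSpace A]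

lemma Regular.intervalIntegrable_jumpMeas (hD : D.Regular) {κ : ℝ} (hκ : D.BoundedBy κ)
    {a : ℝ → Fin d → A} (ha : Measurable a) (Λ : ℝ) (μ : D.SimplexPath) {t : ℝ}
    (ht : t ∈ Icc 0 D.T) :
    IntervalIntegrable (fun s => D.jumpMeas Λ s (a s) (μ.ext hD.T_pos.le s)) volume 0 t :=
  ((μ.continuous_ext _).intervalIntegrable _ _).add
    ((hD.intervalIntegrable_drift hκ ha (μ.continuous_ext _).measurable
      (fun s _ => μ.ext_mem _ s) ht).smul Λ⁻¹)

lemma Regular.intervalIntegrable_exp_jumpMeas (hD : D.Regular) {κ : ℝ} (hκ : D.BoundedBy κ)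
    {a : ℝ → Fin d → A} (ha : Measurable a) (Λ : ℝ) (μ : D.SimplexPath) {t : ℝ}
    (ht : t ∈ Icc 0 D.T) :
    IntervalIntegrable (fun s => Real.exp (Λ * s) • D.jumpMeas Λ s (a s) (μ.ext hD.T_pos.le s))
      volume 0 t :=
  (hD.intervalIntegrable_jumpMeas hκ ha Λ μ ht).continuousOn_smul
    (f := fun s => Real.exp (Λ * s)) (by fun_prop)

/-- The mild form of the Picard iteration, which preserves the simplex. -/
def mildStep (hT : 0 ≤ D.T) (m₀ : EuclideanSpace ℝ (Fin d)) (a : ℝ → Fin d → A) (Λ : ℝ)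
    (μ : D.SimplexPath) (t : ℝ) : EuclideanSpace ℝ (Fin d) :=
  Real.exp (-(Λ * t)) • (m₀ + Λ • ∫ s in (0 : ℝ)..t,
    Real.exp (Λ * s) • D.jumpMeas Λ s (a s) (μ.ext hT s))

/-- The mild step is a convex mixture: weight `exp (-Λt)` on `m₀` and density `Λ exp (-Λ(t - s))` on
points of the simplex, with total weight one. The plain Picard step `m₀ + ∫ drift` could leave the
simplex, where the coefficients are uncontrolled. -/
lemma Regular.mildStep_mem (hD : D.Regular) {κ : ℝ} (hκ : D.BoundedBy κ)
    {m₀ : EuclideanSpace ℝ (Fin d)} (hm₀ : m₀ ∈ simplex d) {a : ℝ → Fin d → A}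
    (ha : Measurable a) {Λ : ℝ} (hΛ : 0 < Λ) (hκΛ : d * κ ≤ Λ) (μ : D.SimplexPath) {t : ℝ}
    (ht : t ∈ Icc 0 D.T) : mildStep hD.T_pos.le m₀ a Λ μ t ∈ simplex d := by
  have hp : ∀ s ∈ Icc 0 t, D.jumpMeas Λ s (a s) (μ.ext hD.T_pos.le s) ∈ simplex d :=
    fun s hs => by
      have hs' : s ∈ Icc 0 D.T := ⟨hs.1, hs.2.trans ht.2⟩
      exact jumpMeas_mem_simplex hΛ hκΛ (μ.ext_mem _ s)
        (fun i j b => hD.Q_nonneg i j s hs' b _ (μ.ext_mem _ s))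
        (fun i j b => (le_abs_self _).trans (hκ.Q_le i j s hs' b _ (μ.ext_mem _ s)))
  have hi := hD.intervalIntegrable_exp_jumpMeas hκ ha Λ μ ht
  have hcoord : ∀ i, mildStep hD.T_pos.le m₀ a Λ μ t i = Real.exp (-(Λ * t)) * (m₀ i + Λ *
      ∫ s in (0 : ℝ)..t, Real.exp (Λ * s) * D.jumpMeas Λ s (a s) (μ.ext hD.T_pos.le s) i) := by
    intro i
    simp only [mildStep, PiLp.smul_apply, PiLp.add_apply, smul_eq_mul,
      intervalIntegral_apply hi]
  refine ⟨fun i => ?_, ?_⟩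
  · rw [hcoord]
    refine mul_nonneg (Real.exp_pos _).le (add_nonneg (hm₀.1 i) (mul_nonneg hΛ.le ?_))
    exact intervalIntegral.integral_nonneg ht.1 fun s hs =>
      mul_nonneg (Real.exp_pos _).le ((hp s hs).1 i)
  · simp_rw [hcoord]
    rw [← Finset.mul_sum, Finset.sum_add_distrib, hm₀.2, ← Finset.mul_sum,
      ← intervalIntegral.integral_finsetSum fun i _ => by
        simpa using intervalIntegrable_apply hi i]
    have : ∫ s in (0 : ℝ)..t, ∑ i, Real.exp (Λ * s) *
        D.jumpMeas Λ s (a s) (μ.ext hD.T_pos.le s) i = ∫ s in (0 : ℝ)..t, Real.exp (Λ * s) := by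
      refine intervalIntegral.integral_congr fun s hs => ?_
      rw [uIcc_of_le ht.1] at hs
      simp only [← Finset.mul_sum, (hp s hs).2, mul_one]
    rw [this, ← intervalIntegral.integral_const_mul, integral_exp_mul, add_sub_cancel,
      ← Real.exp_add, neg_add_cancel, Real.exp_zero]

lemma Regular.continuousOn_mildStep (hD : D.Regular) {κ : ℝ} (hκ : D.BoundedBy κ)
    (m₀ : EuclideanSpace ℝ (Fin d)) {a : ℝ → Fin d → A} (ha : Measurable a) (Λ : ℝ)
    (μ : D.SimplexPath) : ContinuousOn (mildStep hD.T_pos.le m₀ a Λ μ) (Icc 0 D.T) := by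
  have h := intervalIntegral.continuousOn_primitive_interval'
    (hD.intervalIntegrable_exp_jumpMeas hκ ha Λ μ (right_mem_Icc.2 hD.T_pos.le)) left_mem_uIcc
  rw [uIcc_of_le hD.T_pos.le] at h
  exact ContinuousOn.smul (f := fun t => Real.exp (-(Λ * t))) (by fun_prop)
    (continuousOn_const.add (h.const_smul Λ))

/-- `mildStep` as a self-map of the space of paths. -/
def Regular.picard (hD : D.Regular) {κ : ℝ} (hκ : D.BoundedBy κ)
    {m₀ : EuclideanSpace ℝ (Fin d)} (hm₀ : m₀ ∈ simplex d) {a : ℝ → Fin d → A}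
    (ha : Measurable a) {Λ : ℝ} (hΛ : 0 < Λ) (hκΛ : d * κ ≤ Λ) (μ : D.SimplexPath) :
    D.SimplexPath where
  toFun t := ⟨mildStep hD.T_pos.le m₀ a Λ μ t, hD.mildStep_mem hκ hm₀ ha hΛ hκΛ μ t.2⟩
  continuous_toFun :=
    (continuousOn_iff_continuous_domRestrict.1 (hD.continuousOn_mildStep hκ m₀ ha Λ μ)).subtype_mk _

/-- The majorant `b` is left general so that the estimate can be iterated. -/
lemma Regular.norm_mildStep_sub_le (hD : D.Regular) {κ : ℝ} (hκ : D.BoundedBy κ)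
    (m₀ : EuclideanSpace ℝ (Fin d)) {a : ℝ → Fin d → A} (ha : Measurable a) {Λ : ℝ}
    (hΛ : 0 < Λ) (μ ν : D.SimplexPath) {b : ℝ → ℝ} (hb : Continuous b)
    (hμν : ∀ s ∈ Icc 0 D.T, ‖μ.ext hD.T_pos.le s - ν.ext hD.T_pos.le s‖ ≤ b s)
    {t : ℝ} (ht : t ∈ Icc 0 D.T) :
    ‖mildStep hD.T_pos.le m₀ a Λ μ t - mildStep hD.T_pos.le m₀ a Λ ν t‖
      ≤ ∫ s in (0 : ℝ)..t, (Λ + κ) * b s := by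
  -- Bounding `exp (Λs)` by `exp (Λt)` cancels the prefactor of the mild step.
  have hle : ‖∫ s in (0 : ℝ)..t, Real.exp (Λ * s) • (D.jumpMeas Λ s (a s)
      (μ.ext hD.T_pos.le s) - D.jumpMeas Λ s (a s) (ν.ext hD.T_pos.le s))‖
      ≤ ∫ s in (0 : ℝ)..t, Real.exp (Λ * t) * (Λ⁻¹ * ((Λ + κ) * b s)) := by
    refine intervalIntegral.norm_integral_le_of_norm_le ht.1 ?_
      (Continuous.intervalIntegrable (by fun_prop) _ _)
    refine Eventually.of_forall fun s hs => ?_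
    have hs' : s ∈ Icc 0 D.T := ⟨hs.1.le, hs.2.trans ht.2⟩
    have hb0 : 0 ≤ b s := (norm_nonneg _).trans (hμν s hs')
    rw [norm_smul, Real.norm_of_nonneg (Real.exp_pos _).le]
    refine mul_le_mul (Real.exp_le_exp.2 (mul_le_mul_of_nonneg_left hs.2 hΛ.le)) ?_
      (norm_nonneg _) (Real.exp_pos _).le
    have e : D.jumpMeas Λ s (a s) (μ.ext hD.T_pos.le s)
        - D.jumpMeas Λ s (a s) (ν.ext hD.T_pos.le s)
        = (μ.ext hD.T_pos.le s - ν.ext hD.T_pos.le s) + Λ⁻¹ •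
          (D.drift s (a s) (μ.ext hD.T_pos.le s) - D.drift s (a s) (ν.ext hD.T_pos.le s)) := by
      simp only [jumpMeas, smul_sub]; abel
    rw [e]
    refine (norm_add_le _ _).trans ?_
    rw [norm_smul, Real.norm_of_nonneg (inv_nonneg.2 hΛ.le)]
    have h1 := hμν s hs'
    have h2 := (hκ.drift_lip s hs' (a s) _ (μ.ext_mem hD.T_pos.le s) _
      (ν.ext_mem hD.T_pos.le s)).trans
      (mul_le_mul_of_nonneg_left h1 (zero_le_one.trans hκ.one_le))
    have h3 := mul_le_mul_of_nonneg_left h2 (inv_nonneg.2 hΛ.le)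
    calc _ ≤ b s + Λ⁻¹ * (κ * b s) := add_le_add h1 h3
      _ = Λ⁻¹ * ((Λ + κ) * b s) := by field_simp
  have e : mildStep hD.T_pos.le m₀ a Λ μ t - mildStep hD.T_pos.le m₀ a Λ ν t
      = Real.exp (-(Λ * t)) • (Λ • ∫ s in (0 : ℝ)..t, Real.exp (Λ * s) • (D.jumpMeas Λ s (a s)
      (μ.ext hD.T_pos.le s) - D.jumpMeas Λ s (a s) (ν.ext hD.T_pos.le s))) := by
    simp only [smul_sub (Real.exp _) (D.jumpMeas _ _ _ _)]
    rw [intervalIntegral.integral_sub (hD.intervalIntegrable_exp_jumpMeas hκ ha Λ μ ht)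
      (hD.intervalIntegrable_exp_jumpMeas hκ ha Λ ν ht)]
    simp only [mildStep, ← smul_sub, add_sub_add_left_eq_sub]
  rw [e, norm_smul, norm_smul, Real.norm_of_nonneg (Real.exp_pos _).le, Real.norm_of_nonneg hΛ.le]
  refine (mul_le_mul_of_nonneg_left (mul_le_mul_of_nonneg_left hle hΛ.le)
    (Real.exp_pos _).le).trans_eq ?_
  rw [intervalIntegral.integral_const_mul, intervalIntegral.integral_const_mul, Real.exp_neg]
  have := (Real.exp_pos (Λ * t)).ne'
  field_simp

/-- Iterating the Volterra estimate produces the factorial, so some iterate contracts on the whole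
of `[0, T]` at once. -/
lemma Regular.dist_picard_iterate_le (hD : D.Regular) {κ : ℝ} (hκ : D.BoundedBy κ)
    {m₀ : EuclideanSpace ℝ (Fin d)} (hm₀ : m₀ ∈ simplex d) {a : ℝ → Fin d → A}
    (ha : Measurable a) {Λ : ℝ} (hΛ : 0 < Λ) (hκΛ : d * κ ≤ Λ) (μ ν : D.SimplexPath) (n : ℕ)
    (t : Icc (0 : ℝ) D.T) :
    dist ((hD.picard hκ hm₀ ha hΛ hκΛ)^[n] μ t) ((hD.picard hκ hm₀ ha hΛ hκΛ)^[n] ν t)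
      ≤ ((Λ + κ) * t) ^ n / n.factorial * dist μ ν := by
  induction n generalizing t with
  | zero => simpa using ContinuousMap.dist_apply_le_dist t
  | succ n ih =>
    rw [Function.iterate_succ_apply', Function.iterate_succ_apply', Subtype.dist_eq, dist_eq_norm]
    refine (hD.norm_mildStep_sub_le hκ m₀ ha hΛ _ _
      (b := fun s => ((Λ + κ) * s) ^ n / n.factorial * dist μ ν) (by fun_prop) (fun s hs => ?_)
      t.2).trans_eq ?_
    · have := ih (projIcc 0 D.T hD.T_pos.le s)
      rw [Subtype.dist_eq, dist_eq_norm] at this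
      rw [projIcc_of_mem hD.T_pos.le hs] at this
      simpa only [SimplexPath.ext, projIcc_of_mem hD.T_pos.le hs] using this
    · have : ∀ s : ℝ, (Λ + κ) * (((Λ + κ) * s) ^ n / n.factorial * dist μ ν)
          = ((Λ + κ) ^ (n + 1) / n.factorial * dist μ ν) * s ^ n := fun s => by
        rw [mul_pow]; ring
      simp_rw [this]
      rw [intervalIntegral.integral_const_mul, integral_pow, Nat.factorial_succ]
      push_cast
      have h1 : (n.factorial : ℝ) ≠ 0 := by positivity
      field_simp
      simp only [zero_pow (Nat.succ_ne_zero n), sub_zero, mul_pow]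
      ring

/-- Existence for the mild form of the flow equation. -/
lemma Regular.exists_mild (hD : D.Regular) {κ : ℝ} (hκ : D.BoundedBy κ)
    {m₀ : EuclideanSpace ℝ (Fin d)} (hm₀ : m₀ ∈ simplex d) {a : ℝ → Fin d → A}
    (ha : Measurable a) {Λ : ℝ} (hΛ : 0 < Λ) (hκΛ : d * κ ≤ Λ) :
    ∃ μ : D.SimplexPath, ∀ t ∈ Icc 0 D.T, μ.ext hD.T_pos.le t = mildStep hD.T_pos.le m₀ a Λ μ t := by
  have hκ0 : 0 ≤ κ := zero_le_one.trans hκ.one_le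
  obtain ⟨n, hn⟩ := ((FloorSemiring.tendsto_pow_div_factorial_atTop ((Λ + κ) * D.T)).eventually
    (gt_mem_nhds zero_lt_one)).exists
  have h0 : 0 ≤ ((Λ + κ) * D.T) ^ n / n.factorial := by have := hD.T_pos; positivity
  have : CompleteSpace (simplex d) := (isClosed_simplex d).completeSpace_coe
  have : Nonempty D.SimplexPath := ⟨ContinuousMap.const _ ⟨m₀, hm₀⟩⟩
  have hc : ContractingWith (NNReal.mk _ h0) (hD.picard hκ hm₀ ha hΛ hκΛ)^[n] := by
    refine ⟨hn, LipschitzWith.of_dist_le_mul fun μ ν => ?_⟩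
    rw [NNReal.coe_mk, ContinuousMap.dist_le (mul_nonneg h0 dist_nonneg : 0 ≤ ((Λ + κ) * D.T) ^ n / n.factorial * dist μ ν)]
    intro t
    refine (hD.dist_picard_iterate_le hκ hm₀ ha hΛ hκΛ μ ν n t).trans ?_
    refine mul_le_mul_of_nonneg_right ?_ dist_nonneg
    have := t.2.1
    have := t.2.2
    gcongr
  refine ⟨ContractingWith.fixedPoint _ hc, fun t ht => ?_⟩
  -- The fixed point of a contracting iterate is fixed by the map itself.
  have h := hc.isFixedPt_fixedPoint_iterate
  have h1 := congrArg (fun μ : D.SimplexPath => (μ ⟨t, ht⟩ : EuclideanSpace ℝ (Fin d))) h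
  simp only [SimplexPath.ext, projIcc_of_mem hD.T_pos.le ht]
  exact h1.symm

/-- Every measurable control has a flow of laws. -/
lemma Regular.exists_isFlow (hD : D.Regular) {m₀ : EuclideanSpace ℝ (Fin d)}
    (hm₀ : m₀ ∈ simplex d) {a : ℝ → Fin d → A} (ha : Measurable a) : ∃ μ, D.IsFlow m₀ a μ := by
  obtain ⟨κ, hκ⟩ := hD.exists_boundedBy
  have hκ0 : 0 ≤ κ := zero_le_one.trans hκ.one_le
  -- The added `1` keeps `Λ` positive when `d = 0`.
  set Λ : ℝ := d * κ + 1 with hΛdef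
  have hΛ : 0 < Λ := by positivity
  obtain ⟨μ, hμ⟩ := hD.exists_mild hκ hm₀ ha hΛ (by linarith : d * κ ≤ Λ)
  refine ⟨μ.ext hD.T_pos.le, fun t _ => μ.ext_mem _ t, (μ.continuous_ext _).continuousOn,
    fun t ht i => ?_⟩
  change _ = m₀ i + ∫ s in (0 : ℝ)..t, D.drift s (a s) (μ.ext hD.T_pos.le s) i
  set p : ℝ → ℝ := fun s => D.jumpMeas Λ s (a s) (μ.ext hD.T_pos.le s) i with hp
  set I : ℝ → ℝ := fun t => ∫ s in (0 : ℝ)..t, Real.exp (Λ * s) * p s with hI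
  have hpi : IntervalIntegrable p volume 0 t :=
    intervalIntegrable_apply (hD.intervalIntegrable_jumpMeas hκ ha Λ μ ht) i
  have hepi : IntervalIntegrable (fun s => Real.exp (Λ * s) * p s) volume 0 t :=
    hpi.continuousOn_mul (by fun_prop)
  have hμi : ∀ s ∈ Icc 0 t, μ.ext hD.T_pos.le s i = Real.exp (-(Λ * s)) * (m₀ i + Λ * I s) := by
    intro s hs
    have hs' : s ∈ Icc 0 D.T := ⟨hs.1, hs.2.trans ht.2⟩
    rw [hμ s hs']
    simp only [mildStep, PiLp.smul_apply, PiLp.add_apply, smul_eq_mul,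
      intervalIntegral_apply (hD.intervalIntegrable_exp_jumpMeas hκ ha Λ μ hs'), hI, hp]
  have hexp : ∀ s, ∫ r in (0 : ℝ)..s, -Λ * Real.exp (-Λ * r) = Real.exp (-Λ * s) - 1 :=
    fun s => integral_exp_mul (-Λ) s
  -- Integration by parts turns the mild form back into the integral equation. The primitive
  -- vanishing at `0` is `exp (-Λs) - 1`, not `exp (-Λs)`.
  have hibp := integral_mul_primitive_add (t := t) (φ := fun r => -Λ * Real.exp (-Λ * r))
    (Continuous.intervalIntegrable (by fun_prop) _ _) hepi
  simp only [hexp] at hibp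
  have hcongr : ∫ s in (0 : ℝ)..t, (-Λ * Real.exp (-Λ * s) * (∫ r in (0 : ℝ)..s,
      Real.exp (Λ * r) * p r) + (Real.exp (-Λ * s) - 1) * (Real.exp (Λ * s) * p s))
      = ∫ s in (0 : ℝ)..t, (Λ⁻¹ * D.drift s (a s) (μ.ext hD.T_pos.le s) i
        + m₀ i * Λ⁻¹ * (Λ * Real.exp (-(Λ * s))) - Real.exp (Λ * s) * p s) := by
    refine intervalIntegral.integral_congr fun s hs => ?_
    rw [uIcc_of_le ht.1] at hs
    have h1 := hμi s hs
    have h2 : p s = μ.ext hD.T_pos.le s i + Λ⁻¹ * D.drift s (a s) (μ.ext hD.T_pos.le s) i := by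
      simp [hp, jumpMeas]
    have h3 : Real.exp (-Λ * s) * Real.exp (Λ * s) = 1 := by
      rw [← Real.exp_add]; simp
    change -Λ * Real.exp (-Λ * s) * I s + (Real.exp (-Λ * s) - 1) * (Real.exp (Λ * s) * p s)
      = Λ⁻¹ * D.drift s (a s) (μ.ext hD.T_pos.le s) i
        + m₀ i * Λ⁻¹ * (Λ * Real.exp (-(Λ * s))) - Real.exp (Λ * s) * p s
    have h4 : (Real.exp (-Λ * s) - 1) * (Real.exp (Λ * s) * p s)
        = p s - Real.exp (Λ * s) * p s := by
      linear_combination p s * h3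
    have h5 : m₀ i * Λ⁻¹ * (Λ * Real.exp (-(Λ * s))) = m₀ i * Real.exp (-(Λ * s)) := by
      field_simp
    rw [h4, h2, h1, h5, neg_mul Λ s]
    ring
  have hdi : IntervalIntegrable (fun s => D.drift s (a s) (μ.ext hD.T_pos.le s) i) volume 0 t :=
    intervalIntegrable_apply (hD.intervalIntegrable_drift hκ ha (μ.continuous_ext _).measurable
      (fun s _ => μ.ext_mem _ s) ht) i
  have hexp' : ∫ s in (0 : ℝ)..t, Λ * Real.exp (-(Λ * s)) = 1 - Real.exp (-(Λ * t)) := by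
    have := hexp t
    simp only [neg_mul, intervalIntegral.integral_neg] at this
    linarith
  rw [hcongr, intervalIntegral.integral_sub ((hdi.const_mul _).add
    (Continuous.intervalIntegrable (by fun_prop) _ _)) hepi, intervalIntegral.integral_add
    (hdi.const_mul _) (Continuous.intervalIntegrable (by fun_prop) _ _),
    intervalIntegral.integral_const_mul, intervalIntegral.integral_const_mul, hexp'] at hibp
  rw [hμi t (right_mem_Icc.2 ht.1)]
  change _ - I t = (Real.exp (-Λ * t) - 1) * I t at hibp
  rw [neg_mul Λ t] at hibp
  field_simp at hibp
  linarith

end Existence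

end Model

/-! ### Stability of the flow and of the cost under a defect -/

namespace Model

variable {d : ℕ} {A : Type*} {D : Model d A}

/-- The defect of a path `m` in the flow equation of the control `a` started from `m₀`. -/
def defect (D : Model d A) (m₀ : EuclideanSpace ℝ (Fin d)) (a : ℝ → Fin d → A)
    (m : ℝ → EuclideanSpace ℝ (Fin d)) (t : ℝ) : EuclideanSpace ℝ (Fin d) :=
  m t - m₀ - ∫ s in (0 : ℝ)..t, D.drift s (a s) (m s)

/-- The constant in the stability estimate for the cost. -/
def stabilityConst (D : Model d A) (κ : ℝ) : ℝ :=
  κ * (1 + κ * Real.exp (κ * D.T) * (D.T + 1))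

variable [MetricSpace A] [CompactSpace A] [MeasurableSpace A] [BorelSpace A]

lemma Regular.intervalIntegrable_defect (hD : D.Regular) {κ : ℝ} (hκ : D.BoundedBy κ)
    (m₀ : EuclideanSpace ℝ (Fin d)) {a : ℝ → Fin d → A} (ha : Measurable a)
    {m : ℝ → EuclideanSpace ℝ (Fin d)}
    (hm : Measurable m) (hmS : ∀ t ∈ Icc 0 D.T, m t ∈ simplex d) {t : ℝ} (ht : t ∈ Icc 0 D.T) :
    IntervalIntegrable (D.defect m₀ a m) volume 0 t := by
  have h1 : IntervalIntegrable m volume 0 t :=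
    intervalIntegrable_of_bounded hm (fun _ _ => rfl)
      (fun s hs => norm_le_one_of_mem_simplex (hmS s hs)) ht
  have h2 := intervalIntegral.continuousOn_primitive_interval'
    (hD.intervalIntegrable_drift hκ ha hm hmS ht) left_mem_uIcc
  exact (h1.sub intervalIntegrable_const).sub h2.intervalIntegrable

/-- Stability of the flow equation. -/
lemma Regular.norm_sub_flow_le (hD : D.Regular) {κ : ℝ} (hκ : D.BoundedBy κ)
    {m₀ : EuclideanSpace ℝ (Fin d)} {a : ℝ → Fin d → A} (ha : Measurable a)
    {μ : ℝ → EuclideanSpace ℝ (Fin d)} (hμ : D.IsFlow m₀ a μ) (hμm : Measurable μ)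
    {m : ℝ → EuclideanSpace ℝ (Fin d)}
    (hm : Measurable m) (hmS : ∀ t ∈ Icc 0 D.T, m t ∈ simplex d) {t : ℝ} (ht : t ∈ Icc 0 D.T) :
    ‖m t - μ t‖ ≤ ‖D.defect m₀ a m t‖
      + κ * (∫ s in (0 : ℝ)..D.T, ‖D.defect m₀ a m s‖) * Real.exp (κ * D.T) := by
  have hT := hD.T_pos
  have hTm : D.T ∈ Icc 0 D.T := right_mem_Icc.2 hT.le
  have hκ0 : 0 < κ := zero_lt_one.trans_le hκ.one_le
  set e := D.defect m₀ a m with he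
  -- The cutoff makes `δ` integrable on the line, hence its primitive continuous everywhere.
  set δ : ℝ → EuclideanSpace ℝ (Fin d) := (Icc 0 D.T).indicator fun s =>
    D.drift s (a s) (m s) - D.drift s (a s) (μ s) with hδ
  have hint : ∀ {t}, t ∈ Icc 0 D.T → IntervalIntegrable (fun s => D.drift s (a s) (m s)) volume 0 t :=
    fun ht => hD.intervalIntegrable_drift hκ ha hm hmS ht
  have hint' : ∀ {t}, t ∈ Icc 0 D.T → IntervalIntegrable (fun s => D.drift s (a s) (μ s)) volume 0 t :=
    fun ht => hD.intervalIntegrable_drift hκ ha hμm hμ.mem_simplex ht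
  have hδi : Integrable δ := by
    rw [hδ, integrable_indicator_iff measurableSet_Icc,
      ← intervalIntegrable_iff_integrableOn_Icc_of_le hT.le]
    exact (hint hTm).sub (hint' hTm)
  -- Gronwall is run on the integrated difference of drifts, which is continuous, rather than on `‖m
  -- - μ‖`: the path `m` is only measurable.
  set w : ℝ → ℝ := fun t => ‖∫ s in (0 : ℝ)..t, δ s‖ with hw
  have hwc : Continuous w :=
    (intervalIntegral.continuous_primitive (fun a b => hδi.intervalIntegrable) 0).norm
  have hdecomp : ∀ t ∈ Icc 0 D.T, m t - μ t = e t + ∫ s in (0 : ℝ)..t, δ s := by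
    intro t ht
    have h1 : ∫ s in (0 : ℝ)..t, δ s = (∫ s in (0 : ℝ)..t, D.drift s (a s) (m s))
        - ∫ s in (0 : ℝ)..t, D.drift s (a s) (μ s) := by
      rw [← intervalIntegral.integral_sub (hint ht) (hint' ht)]
      refine intervalIntegral.integral_congr fun s hs => ?_
      rw [uIcc_of_le ht.1] at hs
      exact indicator_of_mem (show s ∈ Icc 0 D.T from ⟨hs.1, hs.2.trans ht.2⟩) _
    have h2 : μ t = m₀ + ∫ s in (0 : ℝ)..t, D.drift s (a s) (μ s) := by
      ext i
      rw [hμ.eqn t ht i, PiLp.add_apply, intervalIntegral_apply (hint' ht)]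
      rfl
    rw [h1, he, defect]
    nth_rewrite 1 [h2]
    abel
  have hei : ∀ {t}, t ∈ Icc 0 D.T → IntervalIntegrable (fun s => ‖e s‖) volume 0 t :=
    fun ht => (hD.intervalIntegrable_defect hκ m₀ ha hm hmS ht).norm
  set E := ∫ s in (0 : ℝ)..D.T, ‖e s‖ with hE
  have hgr : ∀ t ∈ Icc 0 D.T, w t ≤ κ * E + κ * ∫ s in (0 : ℝ)..t, w s := by
    intro t ht
    have h1 : w t ≤ ∫ s in (0 : ℝ)..t, κ * (‖e s‖ + w s) := by
      refine intervalIntegral.norm_integral_le_of_norm_le ht.1 ?_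
        (((hei ht).add (hwc.intervalIntegrable _ _)).const_mul κ)
      refine Eventually.of_forall fun s hs => ?_
      have hs' : s ∈ Icc 0 D.T := ⟨hs.1.le, hs.2.trans ht.2⟩
      rw [hδ, indicator_of_mem hs']
      refine (hκ.drift_lip s hs' _ _ (hmS s hs') _ (hμ.mem_simplex s hs')).trans ?_
      refine mul_le_mul_of_nonneg_left ?_ hκ0.le
      rw [hdecomp s hs']
      exact norm_add_le _ _
    rw [intervalIntegral.integral_const_mul,
      intervalIntegral.integral_add (hei ht) (hwc.intervalIntegrable _ _), mul_add] at h1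
    refine h1.trans (add_le_add_left (mul_le_mul_of_nonneg_left ?_ hκ0.le) _)
    exact intervalIntegral.integral_mono_interval le_rfl ht.1 ht.2
      (Eventually.of_forall fun s => norm_nonneg _) (hei hTm)
  have hE0 : 0 ≤ E := intervalIntegral.integral_nonneg hT.le fun s _ => norm_nonneg _
  have hwb := le_exp_of_le_integral hwc hκ0 (fun t => norm_nonneg _) hgr t ht
  rw [hdecomp t ht]
  refine (norm_add_le _ _).trans (add_le_add_right (hwb.trans ?_) _)
  gcongr
  exact ht.2

/-- Stability of the cost: a path solving the flow equation up to a defect has, up to the size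
of the defect, the cost of the control. -/
lemma Regular.abs_cost_sub_le (hD : D.Regular) {κ : ℝ} (hκ : D.BoundedBy κ)
    {m₀ : EuclideanSpace ℝ (Fin d)} {a : ℝ → Fin d → A} (ha : Measurable a)
    {μ : ℝ → EuclideanSpace ℝ (Fin d)} (hμ : D.IsFlow m₀ a μ)
    {m : ℝ → EuclideanSpace ℝ (Fin d)}
    (hm : Measurable m) (hmS : ∀ t ∈ Icc 0 D.T, m t ∈ simplex d) :
    |D.mfCost a m - D.mfCost a μ| ≤ D.stabilityConst κ *
      (‖D.defect m₀ a m D.T‖ + ∫ s in (0 : ℝ)..D.T, ‖D.defect m₀ a m s‖) := by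
  have hT := hD.T_pos
  have hTm : D.T ∈ Icc 0 D.T := right_mem_Icc.2 hT.le
  have hκ0 : 0 < κ := zero_lt_one.trans_le hκ.one_le
  -- A flow is constrained only on `[0, T]`; its constant extension is continuous and has the same
  -- cost.
  wlog hμm : Measurable μ generalizing μ
  · set ν : ℝ → EuclideanSpace ℝ (Fin d) := IccExtend hT.le ((Icc 0 D.T).domRestrict μ) with hν
    have hνc : Continuous ν := (continuousOn_iff_continuous_domRestrict.1 hμ.cont).Icc_extend'
    have hνμ : ∀ t ∈ Icc 0 D.T, ν t = μ t := fun t ht => by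
      rw [hν, IccExtend_of_mem _ _ ht]; rfl
    have hflow : D.IsFlow m₀ a ν := by
      refine ⟨fun t ht => hνμ t ht ▸ hμ.mem_simplex t ht, hνc.continuousOn, fun t ht i => ?_⟩
      rw [hνμ t ht, hμ.eqn t ht i]
      congr 1
      refine intervalIntegral.integral_congr fun s hs => ?_
      rw [uIcc_of_le ht.1] at hs
      simp only [hνμ s ⟨hs.1, hs.2.trans ht.2⟩]
    have hcost : D.mfCost a ν = D.mfCost a μ := by
      unfold mfCost
      rw [hνμ _ hTm]
      congr 1
      refine intervalIntegral.integral_congr fun s hs => ?_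
      rw [uIcc_of_le hT.le] at hs
      simp only [hνμ s hs]
    rw [← hcost]
    exact this hflow hνc.measurable
  set e := D.defect m₀ a m with he
  set E := ∫ s in (0 : ℝ)..D.T, ‖e s‖ with hE
  have hei : IntervalIntegrable (fun s => ‖e s‖) volume 0 D.T :=
    (hD.intervalIntegrable_defect hκ m₀ ha hm hmS hTm).norm
  have hE0 : 0 ≤ E := intervalIntegral.integral_nonneg hT.le fun s _ => norm_nonneg _
  set c := κ * E * Real.exp (κ * D.T) with hc
  have hc0 : 0 ≤ c := by positivity
  have hdist : ∀ t ∈ Icc 0 D.T, ‖m t - μ t‖ ≤ ‖e t‖ + c := fun t ht =>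
    hD.norm_sub_flow_le hκ ha hμ hμm hm hmS ht
  have h1 : |D.G (m D.T) - D.G (μ D.T)| ≤ κ * (‖e D.T‖ + c) :=
    (hκ.G_lip _ (hmS _ hTm) _ (hμ.mem_simplex _ hTm)).trans
      (mul_le_mul_of_nonneg_left (hdist _ hTm) hκ0.le)
  have h2 : |(∫ t in (0 : ℝ)..D.T, D.F t (a t) (m t)) - ∫ t in (0 : ℝ)..D.T, D.F t (a t) (μ t)|
      ≤ κ * (E + D.T * c) := by
    rw [← intervalIntegral.integral_sub (hD.intervalIntegrable_F hκ ha hm hmS hTm)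
      (hD.intervalIntegrable_F hκ ha hμm hμ.mem_simplex hTm), ← Real.norm_eq_abs]
    have : κ * (E + D.T * c) = ∫ s in (0 : ℝ)..D.T, κ * (‖e s‖ + c) := by
      rw [intervalIntegral.integral_const_mul,
        intervalIntegral.integral_add hei intervalIntegrable_const]
      simp [hE]
    rw [this]
    refine intervalIntegral.norm_integral_le_of_norm_le hT.le ?_
      ((hei.add intervalIntegrable_const).const_mul κ)
    refine Eventually.of_forall fun s hs => ?_
    have hs' : s ∈ Icc 0 D.T := ⟨hs.1.le, hs.2⟩
    exact (hκ.F_lip s hs' _ _ (hmS s hs') _ (hμ.mem_simplex s hs')).trans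
      (mul_le_mul_of_nonneg_left (hdist s hs') hκ0.le)
  have h3 : D.mfCost a m - D.mfCost a μ
      = ((∫ t in (0 : ℝ)..D.T, D.F t (a t) (m t)) - ∫ t in (0 : ℝ)..D.T, D.F t (a t) (μ t))
        + (D.G (m D.T) - D.G (μ D.T)) := by
    unfold mfCost; ring
  rw [h3]
  refine (abs_add_le _ _).trans ((add_le_add h2 h1).trans ?_)
  have h4 : 0 ≤ κ * (κ * Real.exp (κ * D.T) * (D.T + 1)) * ‖e D.T‖ := by positivity
  have h5 : κ * (E + D.T * c) + κ * (‖e D.T‖ + c) = D.stabilityConst κ * (‖e D.T‖ + E)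
      - κ * (κ * Real.exp (κ * D.T) * (D.T + 1)) * ‖e D.T‖ := by
    rw [hc, stabilityConst]; ring
  linarith

end Model

/-! ### A feedback as a uniform mixture of deterministic controls -/

section Agents

variable {d N : ℕ}

/-- The agents in state `i`. -/
def agents (x : Fin N → Fin d) (i : Fin d) : Finset (Fin N) :=
  Finset.univ.filter fun k => x k = i

lemma mem_agents {x : Fin N → Fin d} {i : Fin d} {k : Fin N} : k ∈ agents x i ↔ x k = i := by
  simp [agents]

lemma empMeas_eq_card (x : Fin N → Fin d) (i : Fin d) :
    empMeas x i = (agents x i).card / N := by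
  rw [empMeas_apply, agents, Finset.sum_boole]

lemma sum_empMeas_mul (x : Fin N → Fin d) (c : Fin d → ℝ) :
    ∑ i, empMeas x i * c i = (1 / (N : ℝ)) * ∑ k, c (x k) := by
  simp_rw [empMeas_apply, div_mul_eq_mul_div, ← Finset.sum_div, Finset.sum_mul]
  rw [Finset.sum_comm]
  simp [div_eq_inv_mul]

lemma empMeas_update (x : Fin N → Fin d) (k : Fin N) (j i : Fin d) :
    empMeas (Function.update x k j) i - empMeas x i
      = (1 / (N : ℝ)) * ((if j = i then 1 else 0) - if x k = i then 1 else 0) := by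
  rw [empMeas_apply, empMeas_apply, ← sub_div, ← Finset.sum_sub_distrib,
    Finset.sum_eq_single k]
  · simp [div_eq_inv_mul]
  · intro k' _ hk'
    simp [Function.update_of_ne hk']
  · simp

/-- Cyclic enumeration of the agents in state `i` (an arbitrary agent if there is none). -/
def pick (hN : 0 < N) (x : Fin N → Fin d) (i : Fin d) (l : ℕ) : Fin N :=
  if h : 0 < (agents x i).card then
    (agents x i).equivFin.symm ⟨l % (agents x i).card, Nat.mod_lt _ h⟩
  else ⟨0, hN⟩

lemma sum_range_mul_mod (g : ℕ → ℝ) (n q : ℕ) :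
    ∑ l ∈ Finset.range (n * q), g (l % n) = q * ∑ r ∈ Finset.range n, g r := by
  induction q with
  | zero => simp
  | succ q ih =>
    rw [Nat.mul_succ, Finset.sum_range_add, ih]
    have : ∀ r ∈ Finset.range n, g ((n * q + r) % n) = g r := fun r hr => by
      rw [Nat.mul_add_mod, Nat.mod_eq_of_lt (Finset.mem_range.1 hr)]
    rw [Finset.sum_congr rfl this]
    push_cast
    ring

/-- Every possible number of agents in state `i` divides `N!`, so the cyclic enumeration visits each
of them equally often as `l` runs over `N!` indices. If the state is empty both sides vanish, and
the default value of `pick` is harmless. -/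
lemma empMeas_mul_average_pick (hN : 0 < N) (x : Fin N → Fin d) (i : Fin d) (h : Fin N → ℝ) :
    empMeas x i * ((1 / (N.factorial : ℝ)) * ∑ l ∈ Finset.range N.factorial, h (pick hN x i l))
      = (1 / (N : ℝ)) * ∑ k ∈ agents x i, h k := by
  rw [empMeas_eq_card]
  set n := (agents x i).card with hn
  rcases Nat.eq_zero_or_pos n with h0 | hpos
  · have : agents x i = ∅ := Finset.card_eq_zero.1 h0
    simp [h0, this]
  · have hle : n ≤ N := (Finset.card_le_univ _).trans (by simp)
    obtain ⟨q, hq⟩ := Nat.dvd_factorial hpos hle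
    have hfact : (N.factorial : ℝ) ≠ 0 := by positivity
    set g : ℕ → ℝ := fun r => if hr : r < n then h ((agents x i).equivFin.symm ⟨r, hr⟩) else 0
      with hg
    have h1 : ∀ l, h (pick hN x i l) = g (l % n) := fun l => by
      have hl : l % n < n := Nat.mod_lt _ hpos
      rw [pick, dif_pos hpos, hg]
      simp only [hl, dif_pos]
      rfl
    have h2 : ∑ r ∈ Finset.range n, g r = ∑ k ∈ agents x i, h k := by
      rw [Finset.sum_range, ← Finset.sum_coe_sort (agents x i) h, ← Equiv.sum_comp (agents x i).equivFin.symm]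
      exact Finset.sum_congr rfl fun r _ => by simp [hg]
    simp_rw [h1]
    rw [hq, sum_range_mul_mod, h2, Nat.cast_mul]
    have hn0 : (n : ℝ) ≠ 0 := by positivity
    have hq0 : (q : ℝ) ≠ 0 := by
      rintro h0
      apply hfact
      rw [hq, Nat.cast_mul, h0, mul_zero]
    field_simp

/-- One index `l` selects an agent in all states simultaneously, which is what makes each pure
control an element of `A^d`. No independence between states is needed, because the averaged quantity
is a sum over states of terms involving one selected agent each. -/
lemma average_pick (hN : 0 < N) (x : Fin N → Fin d) (h : Fin d → Fin N → ℝ) :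
    (1 / (N.factorial : ℝ)) * ∑ l ∈ Finset.range N.factorial,
        ∑ i, empMeas x i * h i (pick hN x i l)
      = (1 / (N : ℝ)) * ∑ k, h (x k) k := by
  rw [Finset.sum_comm, Finset.mul_sum]
  have h1 : ∀ i, (1 / (N.factorial : ℝ)) * ∑ l ∈ Finset.range N.factorial,
      empMeas x i * h i (pick hN x i l) = (1 / (N : ℝ)) * ∑ k ∈ agents x i, h i k := fun i => by
    rw [← empMeas_mul_average_pick hN x i (h i), ← Finset.mul_sum]
    ring
  simp_rw [h1]
  rw [← Finset.mul_sum]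
  congr 1
  rw [← Finset.sum_fiberwise Finset.univ x fun k => h (x k) k]
  exact Finset.sum_congr rfl fun i _ => Finset.sum_congr rfl fun k hk => by
    rw [mem_agents.1 hk]

end Agents

/-! ### The generator on functions of the empirical measure -/

namespace Model

variable {d N : ℕ} {A : Type*} {D : Model d A}

/-- The `l`-th of the controls whose uniform mixture is the feedback `β` in configuration `x`. -/
def pureControl (hN : 0 < N) (β : ℝ → (Fin N → Fin d) → Fin N → A) (l : ℕ) (t : ℝ)
    (x : Fin N → Fin d) (i : Fin d) : A := β t x (pick hN x i l)

lemma average_F_pureControl (hN : 0 < N) (β : ℝ → (Fin N → Fin d) → Fin N → A) (t : ℝ)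
    (x : Fin N → Fin d) :
    (1 / (N.factorial : ℝ)) * ∑ l ∈ Finset.range N.factorial,
        D.F t (pureControl hN β l t x) (empMeas x)
      = (1 / (N : ℝ)) * ∑ k, D.f (x k) t (β t x k) (empMeas x) :=
  average_pick hN x fun i k => D.f i t (β t x k) (empMeas x)

lemma F_decentralized (α : ℝ → Fin d → A) (t : ℝ) (x : Fin N → Fin d) :
    D.F t (α t) (empMeas x)
      = (1 / (N : ℝ)) * ∑ k, D.f (x k) t (decentralized N α t x k) (empMeas x) :=
  sum_empMeas_mul x fun i => D.f i t (α t i) (empMeas x)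

lemma G_empMeas (x : Fin N → Fin d) :
    D.G (empMeas x) = (1 / (N : ℝ)) * ∑ k, D.g (x k) (empMeas x) :=
  sum_empMeas_mul x fun i => D.g i (empMeas x)

/-- Net rate into state `i` of an agent in state `s`. -/
def netRate (D : Model d A) (i s : Fin d) (t : ℝ) (a : A) (m : EuclideanSpace ℝ (Fin d)) : ℝ :=
  ∑ j, D.Q s j t a m * ((if j = i then 1 else 0) - if s = i then 1 else 0)

lemma drift_eq_sum_netRate (t : ℝ) (a : Fin d → A) (m : EuclideanSpace ℝ (Fin d)) (i : Fin d) :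
    D.drift t a m i = ∑ s, m s * D.netRate i s t (a s) m := by
  simp only [drift_apply, netRate, mul_sub, Finset.sum_sub_distrib]
  simp [Finset.mul_sum]

/-- The diagonal term `j = x k` is multiplied by a zero increment, so it may be included. -/
lemma generator_eq_sum (β : ℝ → (Fin N → Fin d) → Fin N → A) (t : ℝ)
    (φ : (Fin N → Fin d) → ℝ) (x : Fin N → Fin d) :
    D.generator β t φ x = ∑ k, ∑ j,
      D.Q (x k) j t (β t x k) (empMeas x) * (φ (Function.update x k j) - φ x) := by
  refine Finset.sum_congr rfl fun k _ => ?_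
  refine Finset.sum_filter_of_ne fun j _ hj hjx => hj ?_
  rw [hjx, Function.update_eq_self, sub_self, mul_zero]

lemma generator_empMeas (β : ℝ → (Fin N → Fin d) → Fin N → A) (t : ℝ)
    (x : Fin N → Fin d) (i : Fin d) :
    D.generator β t (fun y => empMeas y i) x
      = (1 / (N : ℝ)) * ∑ k, D.netRate i (x k) t (β t x k) (empMeas x) := by
  rw [generator_eq_sum, Finset.mul_sum]
  refine Finset.sum_congr rfl fun k _ => ?_
  rw [netRate, Finset.mul_sum]
  refine Finset.sum_congr rfl fun j _ => ?_
  rw [empMeas_update]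
  ring

/-- Together with `average_F_pureControl`, this says that mixing the pure controls reproduces both
the cost and the mean motion of the chain. Both quantities are linear in the distribution of actions
within each state. -/
lemma average_drift_pureControl (hN : 0 < N) (β : ℝ → (Fin N → Fin d) → Fin N → A) (t : ℝ)
    (x : Fin N → Fin d) (i : Fin d) :
    (1 / (N.factorial : ℝ)) * ∑ l ∈ Finset.range N.factorial,
        D.drift t (pureControl hN β l t x) (empMeas x) i
      = D.generator β t (fun y => empMeas y i) x := by
  simp_rw [generator_empMeas, drift_eq_sum_netRate]
  exact average_pick hN x fun s k => D.netRate i s t (β t x k) (empMeas x)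

/-- No mixing occurs here: agents in the same state take the same action. -/
lemma drift_decentralized (α : ℝ → Fin d → A) (t : ℝ) (x : Fin N → Fin d) (i : Fin d) :
    D.drift t (α t) (empMeas x) i
      = D.generator (decentralized N α) t (fun y => empMeas y i) x := by
  rw [generator_empMeas, drift_eq_sum_netRate]
  exact sum_empMeas_mul x fun s => D.netRate i s t (α t s) (empMeas x)

/-- The carré du champ of the empirical measure is of order `1 / N`. -/
lemma carreDuChamp_le (hN : 0 < N) {κ : ℝ} (hκ : D.BoundedBy κ)
    (β : ℝ → (Fin N → Fin d) → Fin N → A) {t : ℝ} (ht : t ∈ Icc 0 D.T)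
    (x : Fin N → Fin d) (i : Fin d) :
    D.generator β t (fun y => empMeas y i ^ 2) x
        - 2 * empMeas x i * D.generator β t (fun y => empMeas y i) x ≤ d * κ / N := by
  have hκ0 : 0 ≤ κ := zero_le_one.trans hκ.one_le
  have hN' : (N : ℝ) ≠ 0 := by positivity
  -- The left side is a sum of rates times squared jumps: `N d` terms, each at most `κ / N²`.
  have e : D.generator β t (fun y => empMeas y i ^ 2) x
      - 2 * empMeas x i * D.generator β t (fun y => empMeas y i) x
      = ∑ k, ∑ j, D.Q (x k) j t (β t x k) (empMeas x) *
        (empMeas (Function.update x k j) i - empMeas x i) ^ 2 := by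
    simp_rw [generator_eq_sum, Finset.mul_sum, ← Finset.sum_sub_distrib]
    refine Finset.sum_congr rfl fun k _ => Finset.sum_congr rfl fun j _ => ?_
    ring
  rw [e]
  have h1 : ∀ k j, D.Q (x k) j t (β t x k) (empMeas x) *
      (empMeas (Function.update x k j) i - empMeas x i) ^ 2 ≤ κ * (1 / (N : ℝ)) ^ 2 := by
    intro k j
    refine mul_le_mul ((le_abs_self _).trans
      (hκ.Q_le _ _ t ht _ _ (empMeas_mem_simplex hN x))) ?_ (sq_nonneg _) hκ0
    rw [empMeas_update, mul_pow]
    refine mul_le_of_le_one_right (sq_nonneg _) ?_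
    split_ifs <;> norm_num
  refine (Finset.sum_le_sum fun k _ => Finset.sum_le_sum fun j _ => h1 k j).trans_eq ?_
  simp only [Finset.sum_const, Finset.card_univ, Fintype.card_fin, nsmul_eq_mul]
  field_simp

end Model

/-! ### Joint measurability and second moments of compensated processes -/

section Processes

variable {Ω : Type*} [MeasurableSpace Ω]

/-- A right-continuous process is jointly measurable. -/
lemma measurable_uncurry_of_rightContinuous {S : Type*} [TopologicalSpace S]
    [TopologicalSpace.PseudoMetrizableSpace S] [MeasurableSpace S] [BorelSpace S]
    {Y : ℝ → Ω → S} (hY : ∀ s, Measurable (Y s))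
    (hr : ∀ ω s, ContinuousWithinAt (fun s => Y s ω) (Ioi s) s) :
    Measurable (Function.uncurry Y) := by
  -- The first point of the grid of mesh `1 / (n + 1)` strictly after `s`. Strictness, due to the `+
  -- 1` after the floor, gives an approach from the right.
  obtain ⟨τ, hτ⟩ : ∃ τ : ℕ → ℝ → ℝ, ∀ n s,
      τ n s = ((⌊((n : ℝ) + 1) * s⌋ + 1 : ℤ) : ℝ) / ((n : ℝ) + 1) := ⟨_, fun _ _ => rfl⟩
  have hpos : ∀ n : ℕ, (0 : ℝ) < (n : ℝ) + 1 := fun n => by positivity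
  have hlt : ∀ n s, s < τ n s := fun n s => by
    rw [hτ, lt_div_iff₀ (hpos n), mul_comm]
    push_cast
    exact Int.lt_floor_add_one _
  have hle : ∀ n s, τ n s ≤ s + 1 / ((n : ℝ) + 1) := fun n s => by
    have : s + 1 / ((n : ℝ) + 1) = (((n : ℝ) + 1) * s + 1) / ((n : ℝ) + 1) := by
      have := (hpos n).ne'
      field_simp
    rw [this, hτ]
    refine div_le_div_of_nonneg_right ?_ (hpos n).le
    push_cast
    linarith [Int.floor_le (((n : ℝ) + 1) * s)]
  have htend : ∀ s, Tendsto (fun n => τ n s) atTop (𝓝[>] s) := fun s => by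
    refine tendsto_nhdsWithin_iff.2 ⟨?_, Eventually.of_forall fun n => hlt n s⟩
    refine tendsto_of_tendsto_of_tendsto_of_le_of_le tendsto_const_nhds ?_
      (fun n => (hlt n s).le) (fun n => hle n s)
    simpa using tendsto_const_nhds.add (tendsto_one_div_add_atTop_nhds_zero_nat (𝕜 := ℝ))
  refine measurable_of_tendsto_metrizable (f := fun n (p : ℝ × Ω) => Y (τ n p.1) p.2)
    (fun n => ?_) (tendsto_pi_nhds.2 fun p => (hr p.2 p.1).tendsto.comp (htend p.1))
  have h1 : Measurable fun q : ℤ × Ω => Y (((q.1 + 1 : ℤ) : ℝ) / ((n : ℝ) + 1)) q.2 :=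
    measurable_from_prod_countable_right fun z => hY (((z + 1 : ℤ) : ℝ) / ((n : ℝ) + 1))
  have h2 : Measurable fun p : ℝ × Ω => (⌊((n : ℝ) + 1) * p.1⌋, p.2) := by fun_prop
  have h3 : (fun p : ℝ × Ω => Y (τ n p.1) p.2) = (fun q : ℤ × Ω =>
      Y (((q.1 + 1 : ℤ) : ℝ) / ((n : ℝ) + 1)) q.2) ∘
      fun p : ℝ × Ω => (⌊((n : ℝ) + 1) * p.1⌋, p.2) := by
    funext p
    simp only [hτ, Function.comp]
  rw [h3]
  exact h1.comp h2

lemma measurable_intervalIntegral {J : ℝ → Ω → ℝ} (hJ : Measurable (Function.uncurry J))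
    (a b : ℝ) : Measurable fun ω => ∫ s in a..b, J s ω := by
  have h : ∀ a b : ℝ, Measurable fun ω => ∫ s in Ioc a b, J s ω := fun a b =>
    (hJ.stronglyMeasurable.integral_prod_left (μ := volume.restrict (Ioc a b))).measurable
  exact (h a b).sub (h b a)

lemma intervalIntegrable_path {J : ℝ → Ω → ℝ} (hJ : Measurable (Function.uncurry J)) {C : ℝ}
    (hC : ∀ s ω, |J s ω| ≤ C) (ω : Ω) (a b : ℝ) :
    IntervalIntegrable (fun s => J s ω) volume a b := by
  refine (intervalIntegrable_const (c := C)).mono_fun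
    (hJ.comp measurable_prodMk_right).aestronglyMeasurable (Eventually.of_forall fun s => ?_)
  exact (hC s ω).trans (le_abs_self C)

lemma measurable_uncurry_primitive {J : ℝ → Ω → ℝ} (hJ : Measurable (Function.uncurry J))
    {C : ℝ} (hC : ∀ s ω, |J s ω| ≤ C) :
    Measurable (Function.uncurry fun (t : ℝ) ω => ∫ s in (0 : ℝ)..t, J s ω) :=
  measurable_uncurry_of_continuous_of_measurable
    (fun ω => intervalIntegral.continuous_primitive
      (fun a b => intervalIntegrable_path hJ hC ω a b) 0)
    fun t => measurable_intervalIntegral hJ 0 t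

lemma abs_intervalIntegral_le {J : ℝ → ℝ} {C a b : ℝ} (hab : a ≤ b)
    (hC : ∀ s, |J s| ≤ C) : |∫ s in a..b, J s| ≤ C * (b - a) := by
  have := intervalIntegral.norm_integral_le_of_norm_le_const (a := a) (b := b)
    (f := J) (C := C) fun s _ => hC s
  rwa [abs_of_nonneg (sub_nonneg.2 hab)] at this

/-- The second moment of a compensated process in terms of its carré du champ. -/
lemma integral_sq_compensated {P : Measure Ω} [IsProbabilityMeasure P] {t C : ℝ} (ht : 0 ≤ t)
    {Φ ψ χ : ℝ → Ω → ℝ} (hΦ : Measurable (Function.uncurry Φ))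
    (hψ : Measurable (Function.uncurry ψ)) (hχ : Measurable (Function.uncurry χ))
    (hΦC : ∀ s ω, |Φ s ω| ≤ C) (hψC : ∀ s ω, |ψ s ω| ≤ C) (hχC : ∀ s ω, |χ s ω| ≤ C)
    (h₁ : ∫ ω, (Φ t ω ^ 2 - Φ 0 ω ^ 2 - ∫ s in (0 : ℝ)..t, χ s ω) ∂P = 0)
    (h₂ : ∫ ω, Φ 0 ω * (Φ t ω - Φ 0 ω - ∫ s in (0 : ℝ)..t, ψ s ω) ∂P = 0)
    (h₃ : ∀ s ∈ Icc 0 t, ∫ ω, ψ s ω * (Φ t ω - Φ s ω - ∫ r in s..t, ψ r ω) ∂P = 0) :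
    ∫ ω, (Φ t ω - Φ 0 ω - ∫ s in (0 : ℝ)..t, ψ s ω) ^ 2 ∂P
      = ∫ ω, (∫ s in (0 : ℝ)..t, (χ s ω - 2 * Φ s ω * ψ s ω)) ∂P := by
  have hΦs : ∀ s, Measurable (Φ s) := fun s => hΦ.comp measurable_prodMk_left
  have hψi := fun ω => intervalIntegrable_path hψ hψC ω
  have hχi := fun ω => intervalIntegrable_path hχ hχC ω
  have hΨ := measurable_uncurry_primitive hψ hψC
  have hΨs : ∀ s, Measurable fun ω => ∫ r in (0 : ℝ)..s, ψ r ω := fun s =>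
    measurable_intervalIntegral hψ 0 s
  have hsplit : ∀ s ω, ∫ r in s..t, ψ r ω
      = (∫ r in (0 : ℝ)..t, ψ r ω) - ∫ r in (0 : ℝ)..s, ψ r ω := fun s ω =>
    (intervalIntegral.integral_interval_sub_left (hψi ω 0 t) (hψi ω 0 s)).symm
  set Z : ℝ → Ω → ℝ := fun s ω => ψ s ω * (Φ t ω - Φ s ω - ∫ r in s..t, ψ r ω) with hZ
  have hZ' : ∀ s ω, Z s ω = ψ s ω * (Φ t ω - Φ s ω
      - ((∫ r in (0 : ℝ)..t, ψ r ω) - ∫ r in (0 : ℝ)..s, ψ r ω)) := fun s ω => by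
    rw [← hsplit s ω]
  have hZm : Measurable (Function.uncurry Z) := by
    have : Function.uncurry Z = fun p : ℝ × Ω => Function.uncurry ψ p * (Φ t p.2
        - Function.uncurry Φ p - ((∫ r in (0 : ℝ)..t, ψ r p.2)
          - Function.uncurry (fun (t : ℝ) ω => ∫ s in (0 : ℝ)..t, ψ s ω) p)) := by
      ext ⟨s, ω⟩
      exact hZ' s ω
    rw [this]
    exact hψ.mul ((((hΦs t).comp measurable_snd).sub hΦ).sub
      (((hΨs t).comp measurable_snd).sub hΨ))
  have hΨt : ∀ ω, |∫ s in (0 : ℝ)..t, ψ s ω| ≤ C * t := fun ω => by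
    simpa using abs_intervalIntegral_le ht fun s => hψC s ω
  have hC0 : ∀ ω : Ω, 0 ≤ C := fun ω => (abs_nonneg _).trans (hΦC 0 ω)
  have hZC : ∀ s ∈ Icc 0 t, ∀ ω, |Z s ω| ≤ C * (C + C + C * t) := by
    intro s hs ω
    have hC := hC0 ω
    have h1 : |∫ r in s..t, ψ r ω| ≤ C * t :=
      (abs_intervalIntegral_le hs.2 fun r => hψC r ω).trans
        (mul_le_mul_of_nonneg_left (by linarith [hs.1]) hC)
    rw [hZ, abs_mul]
    refine mul_le_mul (hψC s ω) ?_ (abs_nonneg _) hC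
    exact (abs_sub _ _).trans (add_le_add ((abs_sub _ _).trans
      (add_le_add (hΦC _ _) (hΦC _ _))) h1)
  -- A pathwise identity replaces stochastic calculus: expand the square and write the squared
  -- integral of `ψ` as `2 ∫ ψ (∫ ψ)`. Apart from the carré du champ term, each remaining term is a
  -- compensated increment, possibly multiplied by a quantity from its past.
  have hpath : ∀ ω, (Φ t ω - Φ 0 ω - ∫ s in (0 : ℝ)..t, ψ s ω) ^ 2
      = (Φ t ω ^ 2 - Φ 0 ω ^ 2 - ∫ s in (0 : ℝ)..t, χ s ω)
        - 2 * (Φ 0 ω * (Φ t ω - Φ 0 ω - ∫ s in (0 : ℝ)..t, ψ s ω))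
        + (∫ s in (0 : ℝ)..t, (χ s ω - 2 * Φ s ω * ψ s ω))
        - 2 * ∫ s in (0 : ℝ)..t, Z s ω := by
    intro ω
    have hprod : IntervalIntegrable (fun s => 2 * Φ s ω * ψ s ω) volume 0 t := by
      refine intervalIntegrable_path (J := fun s ω => 2 * Φ s ω * ψ s ω) (C := 2 * C * C)
        ((hΦ.const_mul 2).mul hψ) (fun s ω => ?_) ω 0 t
      rw [abs_mul, abs_mul, abs_two]
      exact mul_le_mul (mul_le_mul_of_nonneg_left (hΦC s ω) zero_le_two) (hψC s ω)
        (abs_nonneg _) (mul_nonneg zero_le_two (hC0 ω))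
    have hψΨ : IntervalIntegrable (fun s => ψ s ω * ∫ r in (0 : ℝ)..s, ψ r ω) volume 0 t :=
      (hψi ω 0 t).mul_continuousOn (intervalIntegral.continuous_primitive
        (fun a b => hψi ω a b) 0).continuousOn
    have e1 : ∀ s, Z s ω = (Φ t ω - ∫ r in (0 : ℝ)..t, ψ r ω) * ψ s ω
        - (1 / 2) * (2 * Φ s ω * ψ s ω) + ψ s ω * ∫ r in (0 : ℝ)..s, ψ r ω := fun s => by
      rw [hZ']; ring
    have e2 := integral_mul_primitive_add (hψi ω 0 t) (hψi ω 0 t)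
    have e3 : ∫ s in (0 : ℝ)..t, (ψ s ω * (∫ r in (0 : ℝ)..s, ψ r ω)
        + (∫ r in (0 : ℝ)..s, ψ r ω) * ψ s ω)
        = 2 * ∫ s in (0 : ℝ)..t, ψ s ω * ∫ r in (0 : ℝ)..s, ψ r ω := by
      rw [← intervalIntegral.integral_const_mul]
      exact intervalIntegral.integral_congr fun s _ => by ring
    rw [e3] at e2
    simp_rw [e1]
    rw [intervalIntegral.integral_add (((hψi ω 0 t).const_mul _).sub (hprod.const_mul _)) hψΨ,
      intervalIntegral.integral_sub ((hψi ω 0 t).const_mul _) (hprod.const_mul _),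
      intervalIntegral.integral_const_mul, intervalIntegral.integral_const_mul,
      intervalIntegral.integral_sub (hχi ω 0 t) hprod]
    linear_combination e2
  -- Fubini reduces this to the orthogonality `h₃` at each fixed time `s`.
  have hZ0 : ∫ ω, (∫ s in (0 : ℝ)..t, Z s ω) ∂P = 0 := by
    simp_rw [intervalIntegral.integral_of_le ht]
    rw [integral_integral_swap]
    · refine integral_eq_zero_of_ae ?_
      refine (ae_restrict_iff' measurableSet_Ioc).2 (Eventually.of_forall fun s hs => ?_)
      exact h₃ s ⟨hs.1.le, hs.2⟩
    · refine Integrable.of_bound (C := C * (C + C + C * t))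
        (hZm.comp measurable_swap).aestronglyMeasurable ?_
      refine Measure.ae_prod_iff_ae_ae ?_ |>.2 ?_
      · exact measurableSet_le (hZm.comp measurable_swap).norm measurable_const
      · refine Eventually.of_forall fun ω => (ae_restrict_iff' measurableSet_Ioc).2
          (Eventually.of_forall fun s hs => hZC s ⟨hs.1.le, hs.2⟩ ω)
  have hbdd : ∀ {f : Ω → ℝ} (c : ℝ), Measurable f → (∀ ω, |f ω| ≤ c) → Integrable f P :=
    fun c hf hc => Integrable.of_bound hf.aestronglyMeasurable c (Eventually.of_forall hc)
  have hM : ∀ ω, |Φ t ω - Φ 0 ω - ∫ s in (0 : ℝ)..t, ψ s ω| ≤ C + C + C * t := fun ω =>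
    (abs_sub _ _).trans (add_le_add ((abs_sub _ _).trans
      (add_le_add (hΦC _ _) (hΦC _ _))) (hΨt ω))
  have i₁ : Integrable (fun ω => Φ t ω ^ 2 - Φ 0 ω ^ 2 - ∫ s in (0 : ℝ)..t, χ s ω) P := by
    refine hbdd (C ^ 2 + C ^ 2 + C * t) ((((hΦs t).pow_const 2).sub ((hΦs 0).pow_const 2)).sub
      (measurable_intervalIntegral hχ 0 t)) fun ω => ?_
    have hsq : ∀ s, |Φ s ω ^ 2| ≤ C ^ 2 := fun s => by
      rw [abs_pow]; exact pow_le_pow_left₀ (abs_nonneg _) (hΦC s ω) 2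
    refine (abs_sub _ _).trans (add_le_add ((abs_sub _ _).trans
      (add_le_add (hsq _) (hsq _))) ?_)
    simpa using abs_intervalIntegral_le ht fun s => hχC s ω
  have i₂ : Integrable
      (fun ω => 2 * (Φ 0 ω * (Φ t ω - Φ 0 ω - ∫ s in (0 : ℝ)..t, ψ s ω))) P := by
    refine (hbdd (C * (C + C + C * t)) ((hΦs 0).mul (((hΦs t).sub (hΦs 0)).sub (hΨs t)))
      fun ω => ?_).const_mul 2
    refine (abs_mul (Φ 0 ω) _).trans_le ?_
    exact mul_le_mul (hΦC _ _) (hM ω) (abs_nonneg _) (hC0 ω)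
  have hprodm : Measurable (Function.uncurry fun s ω => χ s ω - 2 * Φ s ω * ψ s ω) :=
    hχ.sub ((hΦ.const_mul 2).mul hψ)
  have i₃ : Integrable (fun ω => ∫ s in (0 : ℝ)..t, (χ s ω - 2 * Φ s ω * ψ s ω)) P := by
    refine hbdd ((C + 2 * C * C) * t) (measurable_intervalIntegral hprodm 0 t) fun ω => ?_
    have := abs_intervalIntegral_le (J := fun s => χ s ω - 2 * Φ s ω * ψ s ω)
      (C := C + 2 * C * C) ht fun s => by
        refine (abs_sub _ _).trans (add_le_add (hχC _ _) ?_)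
        rw [abs_mul, abs_mul, abs_two]
        exact mul_le_mul (mul_le_mul_of_nonneg_left (hΦC s ω) zero_le_two) (hψC s ω)
          (abs_nonneg _) (mul_nonneg zero_le_two (hC0 ω))
    simpa using this
  have i₄ : Integrable (fun ω => 2 * ∫ s in (0 : ℝ)..t, Z s ω) P := by
    refine (hbdd (C * (C + C + C * t) * t) (measurable_intervalIntegral hZm 0 t)
      fun ω => ?_).const_mul 2
    have := intervalIntegral.norm_integral_le_of_norm_le_const (a := 0) (b := t)
      (f := fun s => Z s ω) (C := C * (C + C + C * t)) fun s hs => by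
        rw [uIoc_of_le ht] at hs
        exact hZC s ⟨hs.1.le, hs.2⟩ ω
    rwa [sub_zero, abs_of_nonneg ht] at this
  simp_rw [hpath]
  have i₁₂ : Integrable (fun ω => (Φ t ω ^ 2 - Φ 0 ω ^ 2 - ∫ s in (0 : ℝ)..t, χ s ω)
      - 2 * (Φ 0 ω * (Φ t ω - Φ 0 ω - ∫ s in (0 : ℝ)..t, ψ s ω))) P := i₁.sub i₂
  have i₁₂₃ : Integrable (fun ω => (Φ t ω ^ 2 - Φ 0 ω ^ 2 - ∫ s in (0 : ℝ)..t, χ s ω)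
      - 2 * (Φ 0 ω * (Φ t ω - Φ 0 ω - ∫ s in (0 : ℝ)..t, ψ s ω))
      + ∫ s in (0 : ℝ)..t, (χ s ω - 2 * Φ s ω * ψ s ω)) P := i₁₂.add i₃
  rw [integral_sub i₁₂₃ i₄, integral_add i₁₂ i₃, integral_sub i₁ i₂,
    integral_const_mul, integral_const_mul, h₁, h₂, hZ0]
  ring

/-- Increments of a martingale are orthogonal to the past. -/
lemma integral_mul_martingale_sub {ι : Type*} [Preorder ι] {P : Measure Ω}
    [IsProbabilityMeasure P] {ℱ : Filtration ι (inferInstance : MeasurableSpace Ω)}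
    {M : ι → Ω → ℝ} (hM : Martingale M ℱ P) {s t : ι} (hst : s ≤ t) {Z : Ω → ℝ}
    (hZ : Measurable[ℱ s] Z) {C : ℝ} (hC : ∀ ω, |Z ω| ≤ C) :
    ∫ ω, Z ω * (M t ω - M s ω) ∂P = 0 := by
  have hi : Integrable (M t - M s) P := (hM.integrable t).sub (hM.integrable s)
  have hZi : Integrable (Z * (M t - M s)) P :=
    hi.bdd_mul (hZ.mono (ℱ.le s) le_rfl).aestronglyMeasurable (Eventually.of_forall hC)
  have h1 : P[Z * (M t - M s)|ℱ s] =ᵐ[P] 0 := by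
    have h2 := condExp_mul_of_stronglyMeasurable_left (m := ℱ s) (μ := P)
      hZ.stronglyMeasurable hZi hi
    have h3 := condExp_sub (hM.integrable t) (hM.integrable s) (ℱ s)
    filter_upwards [h2, h3, hM.condExp_ae_eq hst, hM.condExp_ae_eq (le_refl s)] with ω a b c e
    rw [a, Pi.mul_apply, b, Pi.sub_apply, c, e, sub_self, mul_zero, Pi.zero_apply]
  have h4 : ∫ ω, (Z * (M t - M s)) ω ∂P = 0 := by
    rw [← integral_condExp (ℱ.le s), integral_congr_ae h1]
    simp
  exact h4

end Processes

lemma measurable_of_uncurry {Ω : Type*} [MeasurableSpace Ω] {J : ℝ → Ω → ℝ}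
    (hJ : Measurable (Function.uncurry J)) (t : ℝ) : Measurable (J t) :=
  hJ.comp measurable_prodMk_left

lemma measurable_uncurry_comp_process {Ω S : Type*} [MeasurableSpace Ω] [Countable S]
    [MeasurableSpace S] [MeasurableSingletonClass S] {X : ℝ → Ω → S}
    (hX : Measurable (Function.uncurry X)) {h : ℝ → S → ℝ} (hh : ∀ x, Measurable fun s => h s x) :
    Measurable (Function.uncurry fun s ω => h s (X s ω)) := by
  have h1 : Measurable (Function.uncurry h) := measurable_from_prod_countable_left hh
  exact h1.comp (measurable_fst.prodMk hX)

lemma integral_le_of_forall_le {Ω : Type*} [MeasurableSpace Ω] {P : Measure Ω}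
    [IsProbabilityMeasure P] {f : Ω → ℝ} {c : ℝ} (hc : 0 ≤ c) (h : ∀ ω, f ω ≤ c) :
    ∫ ω, f ω ∂P ≤ c := by
  by_cases hf : Integrable f P
  · simpa using integral_mono hf (integrable_const c) h
  -- A non-integrable function has integral `0`, which is where the sign of `c` enters.
  · rw [integral_undef hf]; exact hc

/-- The first moment of a random variable with second moment of order `1 / N`. -/
lemma integral_abs_le_of_integral_sq_le {Ω : Type*} [MeasurableSpace Ω] {P : Measure Ω}
    [IsProbabilityMeasure P] {Z : Ω → ℝ} (hZ : Measurable Z) {C v : ℝ} (hC : ∀ ω, |Z ω| ≤ C)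
    {N : ℕ} (hN : 0 < N) (h : ∫ ω, Z ω ^ 2 ∂P ≤ v / N) :
    ∫ ω, |Z ω| ∂P ≤ (v + 1) / √(N : ℝ) := by
  have hs : 0 < √(N : ℝ) := Real.sqrt_pos.2 (by positivity)
  have hsq : √(N : ℝ) ^ 2 = N := Real.sq_sqrt N.cast_nonneg
  have hv : 0 ≤ v / N := (integral_nonneg fun ω => sq_nonneg _).trans h
  have hv0 : 0 ≤ v := by
    by_contra hneg
    exact absurd hv (not_le.2 (div_neg_of_neg_of_pos (not_le.1 hneg) (by positivity)))
  have i₁ : Integrable (fun ω => |Z ω|) P :=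
    Integrable.of_bound hZ.abs.aestronglyMeasurable C
      (Eventually.of_forall fun ω => by simpa using hC ω)
  have i₂ : Integrable (fun ω => Z ω ^ 2) P :=
    Integrable.of_bound (hZ.pow_const 2).aestronglyMeasurable (C ^ 2)
      (Eventually.of_forall fun ω => by
        rw [norm_pow]; exact pow_le_pow_left₀ (norm_nonneg _) (hC ω) 2)
  -- Young's inequality with weight `√N`, balancing the two terms at order `1 / √N`.
  have h1 : ∫ ω, |Z ω| ∂P ≤ ∫ ω, (√(N : ℝ) / 2 * Z ω ^ 2 + 1 / (2 * √(N : ℝ))) ∂P := by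
    refine integral_mono i₁ ((i₂.const_mul _).add (integrable_const _)) fun ω => ?_
    have h2 : 0 ≤ (√(N : ℝ) * |Z ω| - 1) ^ 2 / (2 * √(N : ℝ)) := by positivity
    have h3 : (√(N : ℝ) * |Z ω| - 1) ^ 2 / (2 * √(N : ℝ))
        = √(N : ℝ) / 2 * Z ω ^ 2 + 1 / (2 * √(N : ℝ)) - |Z ω| := by
      rw [← sq_abs (Z ω)]
      field_simp
      ring
    change |Z ω| ≤ √(N : ℝ) / 2 * Z ω ^ 2 + 1 / (2 * √(N : ℝ))
    linarith
  rw [integral_add (i₂.const_mul _) (integrable_const _), integral_const_mul] at h1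
  simp only [integral_const, probReal_univ, smul_eq_mul, one_mul] at h1
  have h4 := mul_le_mul_of_nonneg_left h (by positivity : 0 ≤ √(N : ℝ) / 2)
  have h5 : √(N : ℝ) / 2 * (v / N) = v / (2 * √(N : ℝ)) := by
    have hN' : (N : ℝ) ≠ 0 := by positivity
    field_simp
    linear_combination v * hsq
  have h6 : (v + 1) / √(N : ℝ) = 2 * (v / (2 * √(N : ℝ)) + 1 / (2 * √(N : ℝ))) := by
    field_simp
  have h7 : 0 ≤ v / (2 * √(N : ℝ)) + 1 / (2 * √(N : ℝ)) := by positivity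
  linarith

/-! ### Fluctuations of the empirical measure of the chain -/

namespace Model

variable {d N : ℕ} {A : Type*} {D : Model d A}

section Clamp

variable {Ω : Type*}

/-- The process stopped outside `[0, T]`. -/
def clamp (hT : 0 ≤ D.T) (X : ℝ → Ω → Fin N → Fin d) (s : ℝ) : Ω → Fin N → Fin d :=
  X (projIcc 0 D.T hT s)

lemma clamp_of_mem (hT : 0 ≤ D.T) (X : ℝ → Ω → Fin N → Fin d) {s : ℝ} (hs : s ∈ Icc 0 D.T) :
    clamp hT X s = X s := by
  rw [clamp, projIcc_of_mem hT hs]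

variable [MeasurableSpace Ω] {m₀ : EuclideanSpace ℝ (Fin d)} {β : ℝ → (Fin N → Fin d) → Fin N → A}
  {P : Measure Ω} {X : ℝ → Ω → Fin N → Fin d}

/-- A chain and its cost only involve times in `[0, T]`. Passing to the clamped process loses
nothing and makes joint measurability on the whole line available. -/
lemma IsChain.clamp (hT : 0 < D.T) (h : D.IsChain m₀ β P X) :
    D.IsChain m₀ β P (clamp hT.le X) := by
  have h0 : (0 : ℝ) ∈ Icc 0 D.T := left_mem_Icc.2 hT.le
  refine ⟨fun ω t ht => ?_, fun ω t ht => ?_, ?_, ?_, ?_⟩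
  · have htI : t ∈ Icc 0 D.T := ⟨ht.1, ht.2.le⟩
    refine (h.right_cont ω t ht).congr_of_eventuallyEq ?_ (by rw [clamp_of_mem _ _ htI])
    filter_upwards [Ioo_mem_nhdsGT ht.2] with s hs
    rw [clamp_of_mem _ _ ⟨ht.1.trans hs.1.le, hs.2.le⟩]
  · obtain ⟨y, hy⟩ := h.left_lim ω t ht
    refine ⟨y, hy.congr' ?_⟩
    filter_upwards [Ioo_mem_nhdsLT ht.1] with s hs
    rw [clamp_of_mem _ _ ⟨hs.1.le, hs.2.le.trans ht.2⟩]
  · rw [clamp_of_mem _ _ h0]; exact h.init_indep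
  · rw [clamp_of_mem _ _ h0]; exact h.init_law
  · obtain ⟨ℱ, hℱ, hM⟩ := h.martingale_problem
    refine ⟨ℱ, fun t => by rw [clamp_of_mem _ _ t.2]; exact hℱ t, fun φ => ?_⟩
    convert! hM φ using 3 with t ω
    rw [clamp_of_mem _ _ t.2, clamp_of_mem _ _ h0]
    congr 1
    refine intervalIntegral.integral_congr fun s hs => ?_
    rw [uIcc_of_le t.2.1] at hs
    simp only [clamp_of_mem hT.le X ⟨hs.1, hs.2.trans t.2.2⟩]

lemma nCost_clamp (hT : 0 < D.T) : D.nCost β P (clamp hT.le X) = D.nCost β P X := by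
  refine integral_congr_ae (Eventually.of_forall fun ω => ?_)
  simp only [clamp_of_mem hT.le X (right_mem_Icc.2 hT.le)]
  congr 1
  refine intervalIntegral.integral_congr fun s hs => ?_
  rw [uIcc_of_le hT.le] at hs
  simp only [clamp_of_mem hT.le X hs]

lemma IsChain.measurable (h : D.IsChain m₀ β P X) {t : ℝ} (ht : t ∈ Icc 0 D.T) :
    Measurable (X t) := by
  obtain ⟨ℱ, hℱ, -⟩ := h.martingale_problem
  exact (hℱ ⟨t, ht⟩).mono (ℱ.le _) le_rfl

/-- Right continuity is known only on `[0, T)`; elsewhere the clamped paths are locally constant to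
the right. -/
lemma IsChain.measurable_uncurry_clamp (hT : 0 < D.T) (h : D.IsChain m₀ β P X) :
    Measurable (Function.uncurry (Model.clamp hT.le X)) := by
  refine measurable_uncurry_of_rightContinuous (fun s => h.measurable (projIcc 0 D.T hT.le s).2)
    fun ω s => ?_
  rcases lt_or_ge s 0 with hs | hs
  · refine (continuousWithinAt_const (b := X 0 ω)).congr_of_eventuallyEq ?_ ?_
    · filter_upwards [mem_nhdsWithin_of_mem_nhds (Iio_mem_nhds hs)] with r hr
      rw [Model.clamp, projIcc_of_le_left _ (le_of_lt hr)]
    · rw [Model.clamp, projIcc_of_le_left _ hs.le]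
  rcases lt_or_ge s D.T with hs' | hs'
  · exact (h.clamp hT).right_cont ω s ⟨hs, hs'⟩
  · refine (continuousWithinAt_const (b := X D.T ω)).congr_of_eventuallyEq ?_ ?_
    · filter_upwards [self_mem_nhdsWithin] with r hr
      rw [Model.clamp, projIcc_of_right_le _ (hs'.trans (le_of_lt hr))]
    · rw [Model.clamp, projIcc_of_right_le _ hs']

end Clamp

/-- The generator, cut off outside `[0, T]`. -/
def cutGenerator (D : Model d A) (β : ℝ → (Fin N → Fin d) → Fin N → A)
    (φ : (Fin N → Fin d) → ℝ) (s : ℝ) (x : Fin N → Fin d) : ℝ :=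
  (Icc 0 D.T).indicator (fun s => D.generator β s φ x) s

lemma cutGenerator_of_mem (β : ℝ → (Fin N → Fin d) → Fin N → A)
    (φ : (Fin N → Fin d) → ℝ) {s : ℝ} (hs : s ∈ Icc 0 D.T) (x : Fin N → Fin d) :
    D.cutGenerator β φ s x = D.generator β s φ x := indicator_of_mem hs _

lemma integral_cutGenerator (β : ℝ → (Fin N → Fin d) → Fin N → A)
    (φ : (Fin N → Fin d) → ℝ) (x : ℝ → Fin N → Fin d) {t : ℝ} (ht : t ∈ Icc 0 D.T) :
    ∫ s in (0 : ℝ)..t, D.cutGenerator β φ s (x s) = ∫ s in (0 : ℝ)..t, D.generator β s φ (x s) := by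
  refine intervalIntegral.integral_congr fun s hs => ?_
  rw [uIcc_of_le ht.1] at hs
  exact cutGenerator_of_mem β φ ⟨hs.1, hs.2.trans ht.2⟩ _

/-- There are finitely many configurations. The bound may depend on `N`, which is harmless: it only
serves integrability, never the rate. -/
lemma exists_cutGenerator_le (hN : 0 < N) {κ : ℝ} (hκ : D.BoundedBy κ)
    (β : ℝ → (Fin N → Fin d) → Fin N → A) (φ : (Fin N → Fin d) → ℝ) :
    ∃ C, ∀ s x, |D.cutGenerator β φ s x| ≤ C := by
  have hκ0 : 0 ≤ κ := zero_le_one.trans hκ.one_le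
  set c : (Fin N → Fin d) → ℝ := fun x => ∑ k, ∑ j, κ * |φ (Function.update x k j) - φ x|
  have hc : ∀ x, 0 ≤ c x := fun x => by positivity
  refine ⟨∑ x, c x, fun s x => ?_⟩
  by_cases hs : s ∈ Icc 0 D.T
  · rw [cutGenerator_of_mem β φ hs, generator_eq_sum]
    refine le_trans ?_ (Finset.single_le_sum (fun y _ => hc y) (Finset.mem_univ x))
    refine (Finset.abs_sum_le_sum_abs _ _).trans (Finset.sum_le_sum fun k _ =>
      (Finset.abs_sum_le_sum_abs _ _).trans (Finset.sum_le_sum fun j _ => ?_))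
    rw [abs_mul]
    exact mul_le_mul_of_nonneg_right (hκ.Q_le _ _ s hs _ _ (empMeas_mem_simplex hN x))
      (abs_nonneg _)
  · rw [cutGenerator, indicator_of_notMem hs, abs_zero]
    exact Finset.sum_nonneg fun y _ => hc y

section Fluctuations

variable {Ω : Type*} {m₀ : EuclideanSpace ℝ (Fin d)}
  {β : ℝ → (Fin N → Fin d) → Fin N → A} {X : ℝ → Ω → Fin N → Fin d}

lemma empMeas_abs_le_one (hN : 0 < N) (x : Fin N → Fin d) (i : Fin d) : |empMeas x i| ≤ 1 :=
  abs_apply_le_one_of_mem_simplex (empMeas_mem_simplex hN x) i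

/-- The martingale part of the empirical measure. -/
def martPart (D : Model d A) (β : ℝ → (Fin N → Fin d) → Fin N → A) (X : ℝ → Ω → Fin N → Fin d)
    (i : Fin d) (t : ℝ) (ω : Ω) : ℝ :=
  empMeas (X t ω) i - empMeas (X 0 ω) i
    - ∫ s in (0 : ℝ)..t, D.cutGenerator β (fun y => empMeas y i) s (X s ω)

lemma exists_martPart_le (hN : 0 < N) {κ : ℝ}
    (hκ : D.BoundedBy κ) (β : ℝ → (Fin N → Fin d) → Fin N → A) (X : ℝ → Ω → Fin N → Fin d)
    (i : Fin d) : ∃ C, ∀ t ∈ Icc 0 D.T, ∀ ω, |D.martPart β X i t ω| ≤ C := by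
  obtain ⟨C, hC⟩ := exists_cutGenerator_le hN hκ β fun y => empMeas y i
  refine ⟨1 + 1 + |C| * D.T, fun t ht ω => ?_⟩
  refine (abs_sub _ _).trans (add_le_add ((abs_sub _ _).trans
    (add_le_add (empMeas_abs_le_one hN _ i) (empMeas_abs_le_one hN _ i))) ?_)
  refine (abs_intervalIntegral_le ht.1 fun s => (hC s _).trans (le_abs_self C)).trans ?_
  rw [sub_zero]
  exact mul_le_mul_of_nonneg_left ht.2 (abs_nonneg _)

/-- The total fluctuation of the empirical measure at time `t`. -/
def noise (D : Model d A) (m₀ : EuclideanSpace ℝ (Fin d))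
    (β : ℝ → (Fin N → Fin d) → Fin N → A) (X : ℝ → Ω → Fin N → Fin d) (t : ℝ) (ω : Ω) : ℝ :=
  ∑ i, (|empMeas (X 0 ω) i - m₀ i| + |D.martPart β X i t ω|)

lemma abs_initial_le (hN : 0 < N) (hm₀ : m₀ ∈ simplex d) (x : Fin N → Fin d) (i : Fin d) :
    |empMeas x i - m₀ i| ≤ 1 + 1 :=
  (abs_sub _ _).trans (add_le_add (empMeas_abs_le_one hN _ i)
    (abs_apply_le_one_of_mem_simplex hm₀ i))

lemma exists_noise_le (hN : 0 < N) {κ : ℝ} (hκ : D.BoundedBy κ) (hm₀ : m₀ ∈ simplex d)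
    (β : ℝ → (Fin N → Fin d) → Fin N → A) (X : ℝ → Ω → Fin N → Fin d) :
    ∃ C, ∀ t ∈ Icc 0 D.T, ∀ ω, |D.noise m₀ β X t ω| ≤ C := by
  choose C hC using exists_martPart_le hN hκ β X
  refine ⟨∑ i, ((1 + 1) + C i), fun t ht ω => ?_⟩
  refine (Finset.abs_sum_le_sum_abs _ _).trans (Finset.sum_le_sum fun i _ => ?_)
  rw [abs_of_nonneg (by positivity)]
  exact add_le_add (abs_initial_le hN hm₀ _ i) (hC i t ht ω)

/-- The constant in the bound on the fluctuations. -/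
def noiseConst (D : Model d A) (κ : ℝ) : ℝ :=
  (1 + D.T) * (d * ((1 + 1) + (D.T * (d * κ) + 1)))

variable [MeasurableSpace Ω] {P : Measure Ω}

/-- Fluctuations of the initial empirical measure. -/
lemma IsChain.integral_initial_sq_le (hT : 0 < D.T) [IsProbabilityMeasure P] (hN : 0 < N)
    (h : D.IsChain m₀ β P X) (i : Fin d) :
    ∫ ω, (empMeas (X 0 ω) i - m₀ i) ^ 2 ∂P ≤ 1 / N := by
  have hX0 : Measurable (X 0) := h.measurable (left_mem_Icc.2 hT.le)
  set ξ : Fin N → Ω → ℝ := fun k ω => if X 0 ω k = i then 1 else 0 with hξ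
  have hξm : ∀ k, Measurable (ξ k) := fun k =>
    (measurable_of_countable fun x : Fin N → Fin d => if x k = i then (1 : ℝ) else 0).comp hX0
  have hξb : ∀ k ω, ξ k ω ∈ Icc (0 : ℝ) 1 := fun k ω => by
    simp only [hξ]; split_ifs <;> simp
  have hL2 : ∀ k, MemLp (ξ k) 2 P := fun k =>
    MemLp.of_bound (hξm k).aestronglyMeasurable 1 (Eventually.of_forall fun ω => by
      rw [Real.norm_of_nonneg (hξb k ω).1]; exact (hξb k ω).2)
  have hmean : ∀ k, ∫ ω, ξ k ω ∂P = m₀ i := fun k => by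
    have hset : MeasurableSet {ω | X 0 ω k = i} :=
      ((measurable_pi_apply k).comp hX0) (measurableSet_singleton i)
    have : ξ k = {ω | X 0 ω k = i}.indicator fun _ => (1 : ℝ) := by
      funext ω; simp [hξ, indicator]
    rw [this, integral_indicator_const _ hset, h.init_law k i]
    simp
  have hindep : iIndepFun ξ P :=
    h.init_indep.comp (fun _ s => if s = i then (1 : ℝ) else 0) fun k => measurable_of_countable _
  -- Independence makes the variances add up, and each is at most `1 / 4`.
  have hvar : Var[∑ k, ξ k; P] ≤ N := by
    rw [IndepFun.variance_sum (fun k _ => hL2 k) fun k _ l _ hkl => hindep.indepFun hkl]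
    refine (Finset.sum_le_card_nsmul _ _ 1 fun k _ => ?_).trans (by simp)
    refine (variance_le_sq_of_bounded (a := 0) (b := 1) (Eventually.of_forall (hξb k))
      (hξm k).aemeasurable).trans (by norm_num)
  rw [variance_eq_integral (Finset.univ.aemeasurable_sum fun k _ => (hξm k).aemeasurable)] at hvar
  have hsum : ∫ ω, (∑ k, ξ k) ω ∂P = N * m₀ i := by
    simp only [Finset.sum_apply]
    rw [integral_finsetSum _ fun k _ => (hL2 k).integrable (by norm_num)]
    simp [hmean]
  rw [hsum] at hvar
  have hN' : (N : ℝ) ≠ 0 := by positivity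
  have heq : ∀ ω, (empMeas (X 0 ω) i - m₀ i) ^ 2
      = (1 / (N : ℝ) ^ 2) * ((∑ k, ξ k) ω - N * m₀ i) ^ 2 := fun ω => by
    rw [empMeas_apply, Finset.sum_apply]
    simp only [hξ]
    field_simp
  simp_rw [heq]
  rw [integral_const_mul]
  refine (mul_le_mul_of_nonneg_left hvar (by positivity)).trans_eq ?_
  field_simp

lemma IsChain.measurable_initial (hT : 0 < D.T) (h : D.IsChain m₀ β P X) (i : Fin d) :
    Measurable fun ω => empMeas (X 0 ω) i - m₀ i :=
  ((measurable_of_countable fun x : Fin N → Fin d => empMeas x i).comp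
    (h.measurable (left_mem_Icc.2 hT.le))).sub_const _

end Fluctuations

section Chain

variable [MetricSpace A] [CompactSpace A] [MeasurableSpace A] [BorelSpace A]
  {Ω : Type*} [MeasurableSpace Ω] {m₀ : EuclideanSpace ℝ (Fin d)}
  {β : ℝ → (Fin N → Fin d) → Fin N → A} {P : Measure Ω} {X : ℝ → Ω → Fin N → Fin d}

lemma Regular.measurable_cutGenerator (hD : D.Regular) (hN : 0 < N)
    (hβ : ∀ x k, Measurable fun t => β t x k) (φ : (Fin N → Fin d) → ℝ) (x : Fin N → Fin d) :
    Measurable fun s => D.cutGenerator β φ s x := by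
  have H : ∀ k j, ∃ h : ℝ → ℝ, Measurable h ∧
      ∀ s ∈ Icc 0 D.T, h s = D.Q (x k) j s (β s x k) (empMeas x) := fun k j =>
    hD.exists_measurable_Q (x k) j measurable_id (hβ x k) (measurable_const (a := empMeas x))
      (fun _ hz => hz) fun _ _ => empMeas_mem_simplex hN x
  choose h hm hI using H
  have : (fun s => D.cutGenerator β φ s x) = (Icc 0 D.T).indicator
      fun s => ∑ k, ∑ j, h k j s * (φ (Function.update x k j) - φ x) := by
    funext s
    by_cases hs : s ∈ Icc 0 D.T
    · rw [cutGenerator_of_mem β φ hs, indicator_of_mem hs, generator_eq_sum]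
      simp only [hI _ _ s hs]
    · rw [cutGenerator, indicator_of_notMem hs, indicator_of_notMem hs]
  rw [this]
  exact (Finset.measurable_sum _ fun k _ => Finset.measurable_sum _ fun j _ =>
    (hm k j).mul_const _).indicator measurableSet_Icc

/-- Orthogonality of the increments of the compensated process to the past. -/
lemma IsChain.integral_mul_compensated (hD : D.Regular) [IsProbabilityMeasure P] (hN : 0 < N)
    {κ : ℝ} (hκ : D.BoundedBy κ) (hβ : ∀ x k, Measurable fun t => β t x k)
    (h : D.IsChain m₀ β P X) (hX : Measurable (Function.uncurry X)) (φ z : (Fin N → Fin d) → ℝ)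
    {s t : ℝ} (hs : s ∈ Icc 0 D.T) (ht : t ∈ Icc 0 D.T) (hst : s ≤ t) :
    ∫ ω, z (X s ω) * (φ (X t ω) - φ (X s ω)
      - ∫ r in s..t, D.cutGenerator β φ r (X r ω)) ∂P = 0 := by
  obtain ⟨ℱ, hℱ, hM⟩ := h.martingale_problem
  obtain ⟨C, hC⟩ := exists_cutGenerator_le hN hκ β φ
  have hz : ∀ ω, |z (X s ω)| ≤ ∑ x, |z x| := fun ω =>
    Finset.single_le_sum (f := fun x => |z x|) (fun x _ => abs_nonneg _) (Finset.mem_univ _)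
  have key := integral_mul_martingale_sub (hM φ) (s := ⟨s, hs⟩) (t := ⟨t, ht⟩) hst
    ((measurable_of_countable z).comp (hℱ ⟨s, hs⟩)) hz
  rw [← key]
  refine integral_congr_ae (Eventually.of_forall fun ω => ?_)
  have hJ := measurable_uncurry_comp_process hX (hD.measurable_cutGenerator hN hβ φ)
  have hi := intervalIntegrable_path hJ (fun s ω => hC s _) ω
  simp only [Function.comp, ← integral_cutGenerator β φ (fun s => X s ω) hs,
    ← integral_cutGenerator β φ (fun s => X s ω) ht,
    ← intervalIntegral.integral_interval_sub_left (hi 0 t) (hi 0 s)]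
  ring

/-- By `integral_sq_compensated`, the second moment is the expected time integral of the carré du
champ, which is at most `d κ / N` at each time. -/
lemma IsChain.integral_martPart_sq_le (hD : D.Regular) [IsProbabilityMeasure P] (hN : 0 < N)
    {κ : ℝ} (hκ : D.BoundedBy κ) (hβ : ∀ x k, Measurable fun t => β t x k)
    (h : D.IsChain m₀ β P X) (hX : Measurable (Function.uncurry X)) (i : Fin d)
    {t : ℝ} (ht : t ∈ Icc 0 D.T) :
    ∫ ω, D.martPart β X i t ω ^ 2 ∂P ≤ (D.T * (d * κ)) / N := by
  have hκ0 : 0 ≤ κ := zero_le_one.trans hκ.one_le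
  have h0 : (0 : ℝ) ∈ Icc 0 D.T := left_mem_Icc.2 hD.T_pos.le
  obtain ⟨C₁, hC₁⟩ := exists_cutGenerator_le hN hκ β fun y => empMeas y i
  obtain ⟨C₂, hC₂⟩ := exists_cutGenerator_le hN hκ β fun y => empMeas y i ^ 2
  have hm₁ := hD.measurable_cutGenerator hN hβ fun y => empMeas y i
  have hm₂ := hD.measurable_cutGenerator hN hβ fun y => empMeas y i ^ 2
  have hΦ := measurable_uncurry_comp_process hX (h := fun _ x => empMeas x i)
    fun x => measurable_const
  have hψ := measurable_uncurry_comp_process hX hm₁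
  have hχ := measurable_uncurry_comp_process hX hm₂
  have a₁ := abs_nonneg C₁
  have a₂ := abs_nonneg C₂
  have key := integral_sq_compensated (P := P) (C := 1 + |C₁| + |C₂|) ht.1 hΦ hψ hχ
    (fun s ω => (empMeas_abs_le_one hN _ i).trans (by linarith))
    (fun s ω => ((hC₁ s _).trans (le_abs_self _)).trans (by linarith))
    (fun s ω => ((hC₂ s _).trans (le_abs_self _)).trans (by linarith))
    (by
      have := h.integral_mul_compensated hD hN hκ hβ hX (fun y => empMeas y i ^ 2)
        (fun _ => 1) h0 ht ht.1
      simpa only [one_mul] using this)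
    (h.integral_mul_compensated hD hN hκ hβ hX (fun y => empMeas y i)
      (fun y => empMeas y i) h0 ht ht.1)
    -- The past factor is the generator term at time `s`, a deterministic function of the
    -- configuration at that time.
    (fun s hs => h.integral_mul_compensated hD hN hκ hβ hX (fun y => empMeas y i)
      (fun y => D.cutGenerator β (fun y => empMeas y i) s y) ⟨hs.1, hs.2.trans ht.2⟩ ht hs.2)
  refine key.trans_le (integral_le_of_forall_le (by have := hD.T_pos; positivity) fun ω => ?_)
  have hc0 : 0 ≤ d * κ / N := by positivity
  have hle : ∫ s in (0 : ℝ)..t, (D.cutGenerator β (fun y => empMeas y i ^ 2) s (X s ω)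
      - 2 * empMeas (X s ω) i * D.cutGenerator β (fun y => empMeas y i) s (X s ω))
      ≤ ∫ s in (0 : ℝ)..t, d * κ / N := by
    refine intervalIntegral.integral_mono_on ht.1 ?_ intervalIntegrable_const fun s hs => ?_
    · refine (intervalIntegrable_path hχ (fun s ω => hC₂ s _) ω 0 t).sub ?_
      refine intervalIntegrable_path (J := fun s ω => 2 * empMeas (X s ω) i *
        D.cutGenerator β (fun y => empMeas y i) s (X s ω)) (C := 2 * 1 * C₁)
        ((hΦ.const_mul 2).mul hψ) (fun s ω => ?_) ω 0 t
      rw [abs_mul, abs_mul, abs_two]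
      exact mul_le_mul (mul_le_mul_of_nonneg_left (empMeas_abs_le_one hN _ i) zero_le_two)
        (hC₁ s _) (abs_nonneg _) (by norm_num)
    · have hs' : s ∈ Icc 0 D.T := ⟨hs.1, hs.2.trans ht.2⟩
      rw [cutGenerator_of_mem β _ hs', cutGenerator_of_mem β _ hs']
      exact carreDuChamp_le hN hκ β hs' _ i
  refine hle.trans ?_
  rw [intervalIntegral.integral_const, smul_eq_mul, sub_zero, mul_div_assoc D.T]
  exact mul_le_mul_of_nonneg_right ht.2 hc0

lemma Regular.measurable_uncurry_martPart (hD : D.Regular) (hN : 0 < N) {κ : ℝ}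
    (hκ : D.BoundedBy κ) (hβ : ∀ x k, Measurable fun t => β t x k)
    (hX : Measurable (Function.uncurry X)) (i : Fin d) :
    Measurable (Function.uncurry (D.martPart β X i)) := by
  obtain ⟨C, hC⟩ := exists_cutGenerator_le hN hκ β fun y => empMeas y i
  have h1 := measurable_uncurry_comp_process hX (h := fun _ x => empMeas x i)
    fun x => measurable_const
  have h2 : Measurable fun p : ℝ × Ω => empMeas (X 0 p.2) i :=
    (h1.comp (measurable_prodMk_left (x := (0 : ℝ)))).comp measurable_snd
  have h3 := measurable_uncurry_primitive (measurable_uncurry_comp_process hX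
    (hD.measurable_cutGenerator hN hβ fun y => empMeas y i)) fun s ω => hC s _
  exact (h1.sub h2).sub h3

lemma IsChain.measurable_uncurry_noise (hD : D.Regular) (hN : 0 < N)
    {κ : ℝ} (hκ : D.BoundedBy κ) (hβ : ∀ x k, Measurable fun t => β t x k)
    (h : D.IsChain m₀ β P X) (hX : Measurable (Function.uncurry X)) :
    Measurable (Function.uncurry (D.noise m₀ β X)) := by
  have h1 : ∀ i, Measurable fun p : ℝ × Ω => |empMeas (X 0 p.2) i - m₀ i| := fun i =>
    ((h.measurable_initial hD.T_pos i).comp measurable_snd).abs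
  have h2 : ∀ i, Measurable fun p : ℝ × Ω => |D.martPart β X i p.1 p.2| := fun i =>
    (hD.measurable_uncurry_martPart (X := X) hN hκ hβ hX i).abs
  exact Finset.measurable_sum Finset.univ fun i _ => (h1 i).add (h2 i)

/-- The constants are `v + 1` from `integral_abs_le_of_integral_sq_le`, with `v = 1` for the initial
states and `v = T d κ` for the martingale, summed over the `d` coordinates. -/
lemma IsChain.integral_noise_apply_le (hD : D.Regular) [IsProbabilityMeasure P] (hN : 0 < N)
    {κ : ℝ} (hκ : D.BoundedBy κ) (hm₀ : m₀ ∈ simplex d)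
    (hβ : ∀ x k, Measurable fun t => β t x k)
    (h : D.IsChain m₀ β P X) (hX : Measurable (Function.uncurry X)) {t : ℝ}
    (ht : t ∈ Icc 0 D.T) :
    ∫ ω, D.noise m₀ β X t ω ∂P ≤ d * ((1 + 1) + (D.T * (d * κ) + 1)) / √(N : ℝ) := by
  have hinit := fun i => h.measurable_initial hD.T_pos i
  have hinit2 : ∀ i ω, |empMeas (X 0 ω) i - m₀ i| ≤ 1 + 1 := fun i ω =>
    abs_initial_le hN hm₀ _ i
  have hmartt : ∀ i, Measurable (D.martPart β X i t) := fun i =>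
    measurable_of_uncurry (hD.measurable_uncurry_martPart hN hκ hβ hX i) t
  choose C hC using exists_martPart_le hN hκ β X
  have i₁ : ∀ i, Integrable (fun ω => |empMeas (X 0 ω) i - m₀ i|) P := fun i =>
    Integrable.of_bound (hinit i).abs.aestronglyMeasurable (1 + 1)
      (Eventually.of_forall fun ω => by
        rw [Real.norm_eq_abs, abs_abs]; exact hinit2 i ω)
  have i₂ : ∀ i, Integrable (fun ω => |D.martPart β X i t ω|) P := fun i =>
    Integrable.of_bound (hmartt i).abs.aestronglyMeasurable (C i)
      (Eventually.of_forall fun ω => by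
        rw [Real.norm_eq_abs, abs_abs]; exact hC i t ht ω)
  have h1 : ∀ i ∈ Finset.univ, ∫ ω, (|empMeas (X 0 ω) i - m₀ i| + |D.martPart β X i t ω|) ∂P
      ≤ (1 + 1) / √(N : ℝ) + (D.T * (d * κ) + 1) / √(N : ℝ) := fun i _ => by
    rw [integral_add (i₁ i) (i₂ i)]
    exact add_le_add
      (integral_abs_le_of_integral_sq_le (hinit i) (hinit2 i) hN
        (h.integral_initial_sq_le hD.T_pos hN i))
      (integral_abs_le_of_integral_sq_le (hmartt i) (hC i t ht) hN
        (h.integral_martPart_sq_le hD hN hκ hβ hX i ht))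
  have i₃ : ∀ i ∈ Finset.univ, Integrable
      (fun ω => |empMeas (X 0 ω) i - m₀ i| + |D.martPart β X i t ω|) P :=
    fun i _ => (i₁ i).add (i₂ i)
  unfold noise
  rw [integral_finsetSum _ i₃]
  refine (Finset.sum_le_card_nsmul _ _ _ h1).trans_eq ?_
  simp only [Finset.card_univ, Fintype.card_fin, nsmul_eq_mul]
  ring

/-- The fluctuations of the empirical measure are of order `1 / √N`. -/
lemma IsChain.integral_noise_le (hD : D.Regular) [IsProbabilityMeasure P] (hN : 0 < N)
    {κ : ℝ} (hκ : D.BoundedBy κ) (hm₀ : m₀ ∈ simplex d)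
    (hβ : ∀ x k, Measurable fun t => β t x k)
    (h : D.IsChain m₀ β P X) (hX : Measurable (Function.uncurry X)) :
    Integrable (fun ω => D.noise m₀ β X D.T ω + ∫ t in (0 : ℝ)..D.T, D.noise m₀ β X t ω) P ∧
    ∫ ω, (D.noise m₀ β X D.T ω + ∫ t in (0 : ℝ)..D.T, D.noise m₀ β X t ω) ∂P
      ≤ D.noiseConst κ / √(N : ℝ) := by
  have hT := hD.T_pos
  have hTm : D.T ∈ Icc 0 D.T := right_mem_Icc.2 hT.le
  have hm := h.measurable_uncurry_noise hD hN hκ hβ hX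
  obtain ⟨C, hC⟩ := exists_noise_le hN hκ hm₀ β X
  have hE := fun t ht => h.integral_noise_apply_le hD hN hκ hm₀ hβ hX (t := t) ht
  have i₁ : Integrable (D.noise m₀ β X D.T) P :=
    Integrable.of_bound (measurable_of_uncurry hm D.T).aestronglyMeasurable C
      (Eventually.of_forall fun ω => hC _ hTm ω)
  have hprod : Integrable (Function.uncurry fun ω t => D.noise m₀ β X t ω)
      (P.prod (volume.restrict (Ioc 0 D.T))) := by
    refine Integrable.of_bound (C := C) (hm.comp measurable_swap).aestronglyMeasurable ?_
    refine Measure.ae_prod_iff_ae_ae ?_ |>.2 ?_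
    · exact measurableSet_le (hm.comp measurable_swap).norm measurable_const
    · exact Eventually.of_forall fun ω => (ae_restrict_iff' measurableSet_Ioc).2
        (Eventually.of_forall fun s hs => hC s ⟨hs.1.le, hs.2⟩ ω)
  have i₂ : Integrable (fun ω => ∫ t in (0 : ℝ)..D.T, D.noise m₀ β X t ω) P := by
    simp_rw [intervalIntegral.integral_of_le hT.le]
    exact hprod.integral_prod_left
  refine ⟨i₁.add i₂, ?_⟩
  rw [integral_add i₁ i₂]
  set c := d * ((1 + 1) + (D.T * (d * κ) + 1)) / √(N : ℝ) with hc
  have h2 : ∫ ω, (∫ t in (0 : ℝ)..D.T, D.noise m₀ β X t ω) ∂P ≤ D.T * c := by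
    have e : ∫ ω, (∫ t in (0 : ℝ)..D.T, D.noise m₀ β X t ω) ∂P
        = ∫ t in (0 : ℝ)..D.T, (∫ ω, D.noise m₀ β X t ω ∂P) := by
      simp_rw [intervalIntegral.integral_of_le hT.le]
      exact integral_integral_swap hprod
    have h3 : ∫ t in (0 : ℝ)..D.T, (∫ ω, D.noise m₀ β X t ω ∂P) ≤ ∫ _ in (0 : ℝ)..D.T, c := by
      refine intervalIntegral.integral_mono_on hT.le ?_ intervalIntegrable_const hE
      rw [intervalIntegrable_iff_integrableOn_Ioc_of_le hT.le]
      exact hprod.integral_prod_right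
    rw [e]
    simpa using h3
  refine (add_le_add (hE _ hTm) h2).trans_eq ?_
  rw [noiseConst, hc]
  ring

end Chain

end Model

lemma tendsto_intervalIntegral_switch {K : ℕ} (hK : 0 < K) {v : ℕ → ℝ → ℝ} {t : ℝ} (ht : 0 ≤ t)
    (hv : ∀ l, IntervalIntegrable (v l) volume 0 t) :
    Tendsto (fun n : ℕ => ∫ s in (0 : ℝ)..t, v (switch K n s) s) atTop
      (𝓝 (∫ s in (0 : ℝ)..t, (1 / (K : ℝ)) * ∑ l ∈ Finset.range K, v l s)) := by
  have h := tendsto_integral_switch hK (v := fun l => (Ioc 0 t).indicator (v l)) fun l =>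
    (integrable_indicator_iff measurableSet_Ioc).2
      ((intervalIntegrable_iff_integrableOn_Ioc_of_le ht).1 (hv l))
  have e1 : ∀ n : ℕ, ∫ s, (Ioc 0 t).indicator (v (switch K n s)) s
      = ∫ s in (0 : ℝ)..t, v (switch K n s) s := fun n => by
    rw [intervalIntegral.integral_of_le ht, ← integral_indicator measurableSet_Ioc]
    rfl
  have e2 : (1 / (K : ℝ)) * ∑ l ∈ Finset.range K, ∫ s, (Ioc 0 t).indicator (v l) s
      = ∫ s in (0 : ℝ)..t, (1 / (K : ℝ)) * ∑ l ∈ Finset.range K, v l s := by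
    rw [intervalIntegral.integral_const_mul,
      intervalIntegral.integral_finsetSum fun l _ => hv l]
    congr 1
    refine Finset.sum_congr rfl fun l _ => ?_
    rw [intervalIntegral.integral_of_le ht, integral_indicator measurableSet_Ioc]
  simp only [e1] at h
  rwa [e2] at h

/-! ### Comparison with the mean field cost along a single trajectory -/

namespace Model

variable {d N : ℕ} {A : Type*} {D : Model d A}

/-- The cost of the `N`-agent problem along a trajectory. -/
def pathCost (D : Model d A) (β : ℝ → (Fin N → Fin d) → Fin N → A) (x : ℝ → Fin N → Fin d) : ℝ :=
  (∫ t in (0 : ℝ)..D.T, (1 / (N : ℝ)) * ∑ k, D.f (x t k) t (β t (x t) k) (empMeas (x t)))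
    + (1 / (N : ℝ)) * ∑ k, D.g (x D.T k) (empMeas (x D.T))

lemma mfCost_empMeas_decentralized (α : ℝ → Fin d → A) (x : ℝ → Fin N → Fin d) :
    D.mfCost α (fun s => empMeas (x s)) = D.pathCost (decentralized N α) x := by
  simp only [mfCost, pathCost, F_decentralized, G_empMeas]

/-- The left side consists of the initial error and the martingale part, separated by the triangle
inequality. -/
lemma sum_abs_le_noise {Ω : Type*} {m₀ : EuclideanSpace ℝ (Fin d)}
    (β : ℝ → (Fin N → Fin d) → Fin N → A) (X : ℝ → Ω → Fin N → Fin d) (ω : Ω) {t : ℝ}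
    (ht : t ∈ Icc 0 D.T) :
    ∑ i, |empMeas (X t ω) i - m₀ i
      - ∫ s in (0 : ℝ)..t, D.generator β s (fun y => empMeas y i) (X s ω)|
      ≤ D.noise m₀ β X t ω := by
  refine Finset.sum_le_sum fun i _ => ?_
  refine le_trans (le_of_eq ?_) (abs_add_le _ _)
  rw [martPart, integral_cutGenerator β _ (fun s => X s ω) ht]
  congr 1
  ring

lemma stabilityConst_nonneg (hT : 0 ≤ D.T) {κ : ℝ} (hκ : D.BoundedBy κ) :
    0 ≤ D.stabilityConst κ := by
  have h0 : 0 ≤ κ := zero_le_one.trans hκ.one_le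
  unfold stabilityConst
  positivity

/-- Indices and configurations form a countable space, so measurability in time for each fixed pair
is enough. -/
lemma measurable_pureControl [MeasurableSpace A] {β : ℝ → (Fin N → Fin d) → Fin N → A}
    (hN : 0 < N) (hβ : ∀ x k, Measurable fun t => β t x k)
    {x : ℝ → Fin N → Fin d} (hx : Measurable x) {σ : ℝ → ℕ} (hσ : Measurable σ) :
    Measurable fun s => pureControl hN β (σ s) s (x s) := by
  have h : Measurable fun p : ℝ × (ℕ × (Fin N → Fin d)) => pureControl hN β p.2.1 p.1 p.2.2 :=
    measurable_from_prod_countable_left fun q =>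
      measurable_pi_lambda _ fun i => hβ q.2 (pick hN q.2 i q.1)
  exact h.comp (measurable_id.prodMk (hσ.prodMk hx))

variable [MetricSpace A] [CompactSpace A] [MeasurableSpace A] [BorelSpace A]

lemma measurable_empMeas_path {x : ℝ → Fin N → Fin d} (hx : Measurable x) :
    Measurable fun s => empMeas (x s) := (measurable_of_countable empMeas).comp hx

lemma Regular.defect_apply (hD : D.Regular) (hN : 0 < N) {κ : ℝ} (hκ : D.BoundedBy κ)
    (m₀ : EuclideanSpace ℝ (Fin d)) {a : ℝ → Fin d → A} (ha : Measurable a)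
    {x : ℝ → Fin N → Fin d} (hx : Measurable x) {t : ℝ} (ht : t ∈ Icc 0 D.T) (i : Fin d) :
    D.defect m₀ a (fun s => empMeas (x s)) t i = empMeas (x t) i - m₀ i
      - ∫ s in (0 : ℝ)..t, D.drift s (a s) (empMeas (x s)) i := by
  rw [defect, PiLp.sub_apply, PiLp.sub_apply, intervalIntegral_apply
    (hD.intervalIntegrable_drift hκ ha (measurable_empMeas_path hx)
      (fun s _ => empMeas_mem_simplex hN _) ht)]

section Upper

variable {Ω : Type*} [MeasurableSpace Ω] {m₀ : EuclideanSpace ℝ (Fin d)}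
  {β : ℝ → (Fin N → Fin d) → Fin N → A} {P : Measure Ω} {X : ℝ → Ω → Fin N → Fin d}

lemma IsChain.intervalIntegrable_noise (hD : D.Regular) (hN : 0 < N)
    {κ : ℝ} (hκ : D.BoundedBy κ) (hm₀ : m₀ ∈ simplex d)
    (hβ : ∀ x k, Measurable fun t => β t x k)
    (h : D.IsChain m₀ β P X) (hX : Measurable (Function.uncurry X)) (ω : Ω) :
    IntervalIntegrable (fun t => D.noise m₀ β X t ω) volume 0 D.T := by
  obtain ⟨C, hC⟩ := exists_noise_le hN hκ hm₀ β X
  exact intervalIntegrable_of_bounded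
    ((h.measurable_uncurry_noise hD hN hκ hβ hX).comp (measurable_prodMk_right (y := ω)))
    (fun _ _ => rfl) (fun t ht => hC t ht ω) (right_mem_Icc.2 hD.T_pos.le)

/-- Along every trajectory, the cost of a decentralized control is close to its mean field
cost. -/
lemma IsChain.pathCost_le (hD : D.Regular) (hN : 0 < N)
    {κ : ℝ} (hκ : D.BoundedBy κ) (hm₀ : m₀ ∈ simplex d) {α : ℝ → Fin d → A}
    (hα : Measurable α) {μ : ℝ → EuclideanSpace ℝ (Fin d)} (hμ : D.IsFlow m₀ α μ)
    (h : D.IsChain m₀ (decentralized N α) P X) (hX : Measurable (Function.uncurry X)) (ω : Ω) :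
    D.pathCost (decentralized N α) (fun t => X t ω) ≤ D.mfCost α μ + D.stabilityConst κ *
      (D.noise m₀ (decentralized N α) X D.T ω
        + ∫ t in (0 : ℝ)..D.T, D.noise m₀ (decentralized N α) X t ω) := by
  have hTm : D.T ∈ Icc 0 D.T := right_mem_Icc.2 hD.T_pos.le
  have hx : Measurable fun t => X t ω := hX.comp measurable_prodMk_right
  have hm := measurable_empMeas_path hx
  have hmS : ∀ t ∈ Icc 0 D.T, empMeas (X t ω) ∈ simplex d := fun t _ => empMeas_mem_simplex hN _
  have hβ : ∀ x k, Measurable fun t => decentralized N α t x k := fun x k =>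
    (measurable_pi_apply (x k)).comp hα
  -- For a decentralized control the drift is the generator on the empirical measure, so the defect
  -- is pure noise.
  have hnorm : ∀ t ∈ Icc 0 D.T, ‖D.defect m₀ α (fun s => empMeas (X s ω)) t‖
      ≤ D.noise m₀ (decentralized N α) X t ω := fun t ht => by
    refine (norm_le_sum_abs _).trans (le_trans (le_of_eq ?_)
      (sum_abs_le_noise (decentralized N α) X ω ht))
    refine Finset.sum_congr rfl fun i _ => ?_
    rw [hD.defect_apply hN hκ m₀ hα hx ht i]
    simp only [drift_decentralized]
  have key := hD.abs_cost_sub_le hκ hα hμ hm hmS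
  rw [mfCost_empMeas_decentralized α fun t => X t ω] at key
  have hle : ‖D.defect m₀ α (fun s => empMeas (X s ω)) D.T‖
      + ∫ s in (0 : ℝ)..D.T, ‖D.defect m₀ α (fun s => empMeas (X s ω)) s‖
      ≤ D.noise m₀ (decentralized N α) X D.T ω
        + ∫ t in (0 : ℝ)..D.T, D.noise m₀ (decentralized N α) X t ω :=
    add_le_add (hnorm _ hTm) (intervalIntegral.integral_mono_on hD.T_pos.le
      (hD.intervalIntegrable_defect hκ m₀ hα hm hmS hTm).norm
      (h.intervalIntegrable_noise hD hN hκ hm₀ hβ hX ω) hnorm)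
  have := mul_le_mul_of_nonneg_left hle (stabilityConst_nonneg hD.T_pos.le hκ)
  have := (le_abs_self _).trans key
  linarith

end Upper

section Lower

variable {m₀ : EuclideanSpace ℝ (Fin d)} {β : ℝ → (Fin N → Fin d) → Fin N → A}

/-- A trajectory of the `N`-agent chain cannot, up to its fluctuations, have a cost below the value
of the mean field problem: its feedback, seen as an open loop relaxed control, is approximated by
fast switching between ordinary controls. -/
lemma Regular.le_pathCost (hD : D.Regular) (hN : 0 < N) {κ : ℝ} (hκ : D.BoundedBy κ)
    (hm₀ : m₀ ∈ simplex d) (hβ : ∀ x k, Measurable fun t => β t x k)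
    {x : ℝ → Fin N → Fin d} (hx : Measurable x) {V : ℝ}
    (hV : ∀ (a : ℝ → Fin d → A) (ν : ℝ → EuclideanSpace ℝ (Fin d)), Measurable a →
      D.IsFlow m₀ a ν → V ≤ D.mfCost a ν) :
    V ≤ D.pathCost β x + D.stabilityConst κ *
      (∑ i, |empMeas (x D.T) i - m₀ i
        - ∫ s in (0 : ℝ)..D.T, D.generator β s (fun y => empMeas y i) (x s)|
      + ∫ t in (0 : ℝ)..D.T, ∑ i, |empMeas (x t) i - m₀ i
        - ∫ s in (0 : ℝ)..t, D.generator β s (fun y => empMeas y i) (x s)|) := by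
  have hT := hD.T_pos
  have hTm : D.T ∈ Icc 0 D.T := right_mem_Icc.2 hT.le
  have hκ0 : 0 ≤ κ := zero_le_one.trans hκ.one_le
  have hm := measurable_empMeas_path hx
  have hmS : ∀ t ∈ Icc 0 D.T, empMeas (x t) ∈ simplex d := fun t _ => empMeas_mem_simplex hN _
  have hK : 0 < N.factorial := N.factorial_pos
  -- The actions prescribed by `β` along the frozen trajectory form an open-loop control that
  -- rotates through the `N!` pure controls at frequency `n`.
  set u : ℕ → ℝ → Fin d → A := fun n s => pureControl hN β (switch N.factorial n s) s (x s)
    with hu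
  have hum : ∀ n, Measurable (u n) := fun n =>
    measurable_pureControl hN hβ hx (measurable_switch _ n)
  have hlm : ∀ l : ℕ, Measurable fun s => pureControl hN β l s (x s) := fun l =>
    measurable_pureControl hN hβ hx measurable_const
  have hF : Tendsto (fun n => D.mfCost (u n) fun s => empMeas (x s)) atTop
      (𝓝 (D.pathCost β x)) := by
    have h1 := tendsto_intervalIntegral_switch hK hT.le
      (v := fun l s => D.F s (pureControl hN β l s (x s)) (empMeas (x s))) fun l =>
        hD.intervalIntegrable_F hκ (hlm l) hm hmS hTm
    simp only [average_F_pureControl] at h1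
    have h2 := h1.add_const (D.G (empMeas (x D.T)))
    rw [G_empMeas] at h2
    rw [pathCost]
    refine h2.congr fun n => ?_
    rw [← G_empMeas]
    rfl
  -- In the limit the drift is averaged to the generator, and the defect becomes the fluctuation of
  -- the trajectory.
  have hdef : ∀ t ∈ Icc 0 D.T, ∀ i, Tendsto
      (fun n => D.defect m₀ (u n) (fun s => empMeas (x s)) t i) atTop
      (𝓝 (empMeas (x t) i - m₀ i
        - ∫ s in (0 : ℝ)..t, D.generator β s (fun y => empMeas y i) (x s))) := by
    intro t ht i
    have h1 := tendsto_intervalIntegral_switch hK ht.1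
      (v := fun l s => D.drift s (pureControl hN β l s (x s)) (empMeas (x s)) i) fun l =>
        intervalIntegrable_apply (hD.intervalIntegrable_drift hκ (hlm l) hm hmS ht) i
    simp only [average_drift_pureControl] at h1
    refine (h1.const_sub (empMeas (x t) i - m₀ i)).congr fun n => ?_
    rw [hD.defect_apply hN hκ m₀ (hum n) hx ht i]
  have hdefS : ∀ t ∈ Icc 0 D.T, Tendsto
      (fun n => ∑ i, |D.defect m₀ (u n) (fun s => empMeas (x s)) t i|) atTop
      (𝓝 (∑ i, |empMeas (x t) i - m₀ i
        - ∫ s in (0 : ℝ)..t, D.generator β s (fun y => empMeas y i) (x s)|)) := fun t ht =>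
    tendsto_finsetSum _ fun i _ => (hdef t ht i).abs
  have hdi : ∀ n, IntervalIntegrable (D.defect m₀ (u n) fun s => empMeas (x s)) volume 0 D.T :=
    fun n => hD.intervalIntegrable_defect hκ m₀ (hum n) hm hmS hTm
  have hdiS : ∀ n, IntervalIntegrable
      (fun t => ∑ i, |D.defect m₀ (u n) (fun s => empMeas (x s)) t i|) volume 0 D.T := fun n => by
    have e : (fun t => ∑ i, |D.defect m₀ (u n) (fun s => empMeas (x s)) t i|)
        = ∑ i, fun t => |D.defect m₀ (u n) (fun s => empMeas (x s)) t i| := by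
      funext t
      rw [Finset.sum_apply]
    rw [e]
    exact IntervalIntegrable.sum Finset.univ
      fun i _ => (intervalIntegrable_apply (hdi n) i).abs
  have hbd : ∀ n, ∀ t ∈ Icc 0 D.T, ∀ i,
      |D.defect m₀ (u n) (fun s => empMeas (x s)) t i| ≤ 1 + 1 + κ * D.T := by
    intro n t ht i
    refine (abs_apply_le_norm _ i).trans ((norm_sub_le _ _).trans (add_le_add
      ((norm_sub_le _ _).trans (add_le_add (norm_le_one_of_mem_simplex (hmS t ht))
        (norm_le_one_of_mem_simplex hm₀))) ?_))
    refine (intervalIntegral.norm_integral_le_of_norm_le_const (C := κ) fun s hs => ?_).trans ?_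
    · rw [uIoc_of_le ht.1] at hs
      have hs' : s ∈ Icc 0 D.T := ⟨hs.1.le, hs.2.trans ht.2⟩
      exact hκ.drift_le s hs' _ _ (hmS s hs')
    · rw [sub_zero, abs_of_nonneg ht.1]
      exact mul_le_mul_of_nonneg_left ht.2 hκ0
  have hint : Tendsto (fun n => ∫ t in (0 : ℝ)..D.T,
      ∑ i, |D.defect m₀ (u n) (fun s => empMeas (x s)) t i|) atTop
      (𝓝 (∫ t in (0 : ℝ)..D.T, ∑ i, |empMeas (x t) i - m₀ i
        - ∫ s in (0 : ℝ)..t, D.generator β s (fun y => empMeas y i) (x s)|)) := by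
    refine intervalIntegral.tendsto_integral_filter_of_dominated_convergence
      (fun _ => ∑ _i : Fin d, (1 + 1 + κ * D.T)) ?_ ?_ intervalIntegrable_const ?_
    · refine Eventually.of_forall fun n => ?_
      rw [uIoc_of_le hT.le]
      exact (hdiS n).1.aestronglyMeasurable
    · refine Eventually.of_forall fun n => Eventually.of_forall fun t ht => ?_
      rw [uIoc_of_le hT.le] at ht
      rw [Real.norm_of_nonneg (Finset.sum_nonneg fun i _ => abs_nonneg _)]
      exact Finset.sum_le_sum fun i _ => hbd n t ⟨ht.1.le, ht.2⟩ i
    · refine Eventually.of_forall fun t ht => ?_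
      rw [uIoc_of_le hT.le] at ht
      exact hdefS t ⟨ht.1.le, ht.2⟩
  -- The inequality is proved at each finite frequency, by stability against the flow of `u n`, and
  -- then passed to the limit; the flows themselves need not converge.
  refine ge_of_tendsto' (hF.add (((hdefS _ hTm).add hint).const_mul (D.stabilityConst κ)))
    fun n => ?_
  obtain ⟨ν, hν⟩ := hD.exists_isFlow hm₀ (hum n)
  have h1 := hV (u n) ν (hum n) hν
  have h2 := (neg_abs_le _).trans' (neg_le_neg (hD.abs_cost_sub_le hκ (hum n) hν hm hmS))
  have h3 : ‖D.defect m₀ (u n) (fun s => empMeas (x s)) D.T‖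
      + ∫ s in (0 : ℝ)..D.T, ‖D.defect m₀ (u n) (fun s => empMeas (x s)) s‖
      ≤ ∑ i, |D.defect m₀ (u n) (fun s => empMeas (x s)) D.T i|
        + ∫ t in (0 : ℝ)..D.T, ∑ i, |D.defect m₀ (u n) (fun s => empMeas (x s)) t i| :=
    add_le_add (norm_le_sum_abs _) (intervalIntegral.integral_mono_on hT.le
      (hdi n).norm (hdiS n) fun t _ => norm_le_sum_abs _)
  have h4 := mul_le_mul_of_nonneg_left h3 (stabilityConst_nonneg hD.T_pos.le hκ)
  linarith

end Lower

end Model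

/-! ### Comparison in expectation -/

namespace Model

variable {d N : ℕ} {A : Type*} {D : Model d A}
  [MetricSpace A] [CompactSpace A] [MeasurableSpace A] [BorelSpace A]
  {Ω : Type*} [MeasurableSpace Ω] {m₀ : EuclideanSpace ℝ (Fin d)}
  {β : ℝ → (Fin N → Fin d) → Fin N → A} {P : Measure Ω} {X : ℝ → Ω → Fin N → Fin d}

/-- The individual costs `f i` carry no regularity assumption; only the aggregate `F` is continuous.
Measurability and boundedness of the running cost are obtained by writing it as an average of `F`
over pure controls. -/
lemma Regular.integrable_pathCost (hD : D.Regular) [IsProbabilityMeasure P] (hN : 0 < N)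
    {κ : ℝ} (hκ : D.BoundedBy κ) (hβ : ∀ x k, Measurable fun t => β t x k)
    (hX : Measurable (Function.uncurry X)) :
    Integrable (fun ω => D.pathCost β fun t => X t ω) P := by
  have hT := hD.T_pos
  have hκ0 : 0 ≤ κ := zero_le_one.trans hκ.one_le
  set c : ℝ → (Fin N → Fin d) → ℝ := fun s x => (Icc 0 D.T).indicator
    (fun s => (1 / (N : ℝ)) * ∑ k, D.f (x k) s (β s x k) (empMeas x)) s with hc
  have hcF : ∀ s ∈ Icc 0 D.T, ∀ x, c s x = (1 / (N.factorial : ℝ)) *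
      ∑ l ∈ Finset.range N.factorial, D.F s (pureControl hN β l s x) (empMeas x) :=
    fun s hs x => by rw [average_F_pureControl]; exact indicator_of_mem hs _
  have hcm : ∀ x, Measurable fun s => c s x := fun x => by
    have H : ∀ l : ℕ, ∃ h : ℝ → ℝ, Measurable h ∧
        ∀ s ∈ Icc 0 D.T, h s = D.F s (pureControl hN β l s x) (empMeas x) := fun l =>
      hD.exists_measurable_F measurable_id
        (measurable_pi_lambda _ fun i => hβ x (pick hN x i l))
        (measurable_const (a := empMeas x)) (fun _ hz => hz) fun _ _ => empMeas_mem_simplex hN x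
    choose h hm hI using H
    have : (fun s => c s x) = (Icc 0 D.T).indicator
        fun s => (1 / (N.factorial : ℝ)) * ∑ l ∈ Finset.range N.factorial, h l s := by
      funext s
      by_cases hs : s ∈ Icc 0 D.T
      · rw [hcF s hs, indicator_of_mem hs]
        simp only [hI _ s hs]
      · simp only [hc, indicator_of_notMem hs]
    rw [this]
    exact ((Finset.measurable_sum _ fun l _ => hm l).const_mul _).indicator measurableSet_Icc
  have hcb : ∀ s x, |c s x| ≤ κ := fun s x => by
    by_cases hs : s ∈ Icc 0 D.T
    · have hK : (0 : ℝ) < N.factorial := by exact_mod_cast N.factorial_pos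
      rw [hcF s hs, abs_mul, abs_of_nonneg (by positivity)]
      have h1 : |∑ l ∈ Finset.range N.factorial, D.F s (pureControl hN β l s x) (empMeas x)|
          ≤ N.factorial * κ :=
        (Finset.abs_sum_le_sum_abs _ _).trans ((Finset.sum_le_card_nsmul _ _ κ fun l _ =>
          hκ.F_le s hs _ _ (empMeas_mem_simplex hN x)).trans (by simp))
      refine (mul_le_mul_of_nonneg_left h1 (by positivity)).trans_eq ?_
      field_simp
    · simpa only [hc, indicator_of_notMem hs, abs_zero] using hκ0
  have hJ := measurable_uncurry_comp_process hX hcm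
  have heq : (fun ω => D.pathCost β fun t => X t ω)
      = fun ω => (∫ s in (0 : ℝ)..D.T, c s (X s ω)) + D.G (empMeas (X D.T ω)) := by
    funext ω
    rw [pathCost, G_empMeas]
    congr 1
    refine intervalIntegral.integral_congr fun s hs => ?_
    rw [uIcc_of_le hT.le] at hs
    simp only [hc, indicator_of_mem hs]
  rw [heq]
  refine Integrable.add ?_ ?_
  · exact Integrable.of_bound (measurable_intervalIntegral hJ 0 D.T).aestronglyMeasurable
      (κ * (D.T - 0)) (Eventually.of_forall fun ω => abs_intervalIntegral_le hT.le fun s => hcb s _)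
  · have hXT : Measurable (X D.T) := hX.comp (measurable_prodMk_left (x := D.T))
    exact Integrable.of_bound
      ((measurable_of_countable fun x : Fin N → Fin d => D.G (empMeas x)).comp
        hXT).aestronglyMeasurable κ
      (Eventually.of_forall fun ω => hκ.G_le _ (empMeas_mem_simplex hN _))

/-- The constant in the comparison of the `N`-agent and the mean field costs. -/
def rateConst (D : Model d A) (κ : ℝ) : ℝ := D.stabilityConst κ * D.noiseConst κ

/-- The cost of a decentralized control in the `N`-agent problem exceeds its mean field cost by
at most `C / √N`. -/
lemma IsChain.nCost_decentralized_le (hD : D.Regular) [IsProbabilityMeasure P] (hN : 0 < N)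
    {κ : ℝ} (hκ : D.BoundedBy κ) (hm₀ : m₀ ∈ simplex d) {α : ℝ → Fin d → A}
    (hα : Measurable α) {μ : ℝ → EuclideanSpace ℝ (Fin d)} (hμ : D.IsFlow m₀ α μ)
    (h : D.IsChain m₀ (decentralized N α) P X) :
    D.nCost (decentralized N α) P X ≤ D.mfCost α μ + D.rateConst κ / √(N : ℝ) := by
  have hβ : ∀ x k, Measurable fun t => decentralized N α t x k := fun x k =>
    (measurable_pi_apply (x k)).comp hα
  have hX := h.measurable_uncurry_clamp hD.T_pos
  have h' := h.clamp hD.T_pos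
  rw [← nCost_clamp hD.T_pos]
  obtain ⟨hi, hle⟩ := h'.integral_noise_le hD hN hκ hm₀ hβ hX
  have hs := stabilityConst_nonneg hD.T_pos.le hκ
  calc D.nCost (decentralized N α) P (Model.clamp hD.T_pos.le X)
      = ∫ ω, D.pathCost (decentralized N α) (fun t => Model.clamp hD.T_pos.le X t ω) ∂P := rfl
    _ ≤ ∫ ω, (D.mfCost α μ + D.stabilityConst κ *
          (D.noise m₀ (decentralized N α) (Model.clamp hD.T_pos.le X) D.T ω + ∫ t in (0 : ℝ)..D.T,
            D.noise m₀ (decentralized N α) (Model.clamp hD.T_pos.le X) t ω)) ∂P :=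
        integral_mono (hD.integrable_pathCost hN hκ hβ hX)
          ((integrable_const _).add (hi.const_mul _))
          fun ω => h'.pathCost_le hD hN hκ hm₀ hα hμ hX ω
    _ ≤ D.mfCost α μ + D.rateConst κ / √(N : ℝ) := by
        rw [integral_add (integrable_const _) (hi.const_mul _), integral_const_mul]
        simp only [integral_const, probReal_univ, one_smul]
        rw [rateConst, mul_div_assoc]
        exact add_le_add_right (mul_le_mul_of_nonneg_left hle hs) _

/-- Every lower bound on the mean field costs is, up to `C / √N`, a lower bound on the costs of the
`N`-agent problem. -/
lemma IsChain.le_nCost (hD : D.Regular) [IsProbabilityMeasure P] (hN : 0 < N)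
    {κ : ℝ} (hκ : D.BoundedBy κ) (hm₀ : m₀ ∈ simplex d)
    (hβ : ∀ x k, Measurable fun t => β t x k) (h : D.IsChain m₀ β P X) {V : ℝ}
    (hV : ∀ (a : ℝ → Fin d → A) (ν : ℝ → EuclideanSpace ℝ (Fin d)), Measurable a →
      D.IsFlow m₀ a ν → V ≤ D.mfCost a ν) :
    V ≤ D.nCost β P X + D.rateConst κ / √(N : ℝ) := by
  have hTm : D.T ∈ Icc 0 D.T := right_mem_Icc.2 hD.T_pos.le
  have hX := h.measurable_uncurry_clamp hD.T_pos
  have h' := h.clamp hD.T_pos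
  rw [← nCost_clamp hD.T_pos]
  set Y := Model.clamp hD.T_pos.le X with hY
  obtain ⟨hi, hle⟩ := h'.integral_noise_le hD hN hκ hm₀ hβ hX
  have hs := stabilityConst_nonneg hD.T_pos.le hκ
  have hpath : ∀ ω, V ≤ D.pathCost β (fun t => Y t ω) + D.stabilityConst κ *
      (D.noise m₀ β Y D.T ω + ∫ t in (0 : ℝ)..D.T, D.noise m₀ β Y t ω) := fun ω => by
    have hx : Measurable fun t => Y t ω := hX.comp measurable_prodMk_right
    refine (hD.le_pathCost hN hκ hm₀ hβ hx hV).trans (add_le_add_right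
      (mul_le_mul_of_nonneg_left (add_le_add (sum_abs_le_noise β Y ω hTm) ?_) hs) _)
    rw [intervalIntegral.integral_of_le hD.T_pos.le, intervalIntegral.integral_of_le hD.T_pos.le]
    -- This form of monotonicity needs integrability of the larger function only.
    refine integral_mono_of_nonneg
      (Eventually.of_forall fun t => Finset.sum_nonneg fun i _ => abs_nonneg _)
      (h'.intervalIntegrable_noise hD hN hκ hm₀ hβ hX ω).1 ?_
    exact (ae_restrict_iff' measurableSet_Ioc).2 (Eventually.of_forall fun t ht =>
      sum_abs_le_noise β Y ω ⟨ht.1.le, ht.2⟩)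
  have hcost := hD.integrable_pathCost (P := P) hN hκ hβ hX
  calc V = ∫ _, V ∂P := by simp
    _ ≤ ∫ ω, (D.pathCost β (fun t => Y t ω) + D.stabilityConst κ *
          (D.noise m₀ β Y D.T ω + ∫ t in (0 : ℝ)..D.T, D.noise m₀ β Y t ω)) ∂P :=
        integral_mono (integrable_const _) (hcost.add (hi.const_mul _)) hpath
    _ ≤ D.nCost β P Y + D.rateConst κ / √(N : ℝ) := by
        rw [integral_add hcost (hi.const_mul _), integral_const_mul, rateConst, mul_div_assoc]
        exact add_le_add_right (mul_le_mul_of_nonneg_left hle hs) _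

end Model

end MFC

end

/-- Infima are expressed by comparison with each competitor. The chains are arbitrary solutions of
the martingale problem, possibly on different probability spaces, so neither their existence nor
their uniqueness in law is involved. -/
theorem theorem2p7 {d : ℕ} {A : Type*} [MetricSpace A] [CompactSpace A] [MeasurableSpace A]
    [BorelSpace A] (D : MFC.Model d A) (hD : D.Regular) :
    ∃ C : ℝ, ∀ m₀ ∈ MFC.simplex d, ∀ N : ℕ, 0 < N → ∀ ε : ℝ, 0 < ε →
      ∀ α : ℝ → Fin d → A, D.IsEpsOptimal m₀ ε α →
      ∀ (Ω : Type*) [MeasurableSpace Ω] (P : Measure Ω) [IsProbabilityMeasure P]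
        (X : ℝ → Ω → Fin N → Fin d), D.IsChain m₀ (MFC.decentralized N α) P X →
      ∀ (Ω' : Type*) [MeasurableSpace Ω'] (P' : Measure Ω') [IsProbabilityMeasure P']
        (X' : ℝ → Ω' → Fin N → Fin d),
        -- infimum over symmetric feedback controls of time, own state and empirical measure
        (∀ αN : ℝ → Fin d → EuclideanSpace ℝ (Fin d) → A,
          (∀ i, ∀ x : Fin N → Fin d, Measurable (fun t => αN t i (MFC.empMeas x))) →
          D.IsChain m₀ (MFC.meanFieldFeedback N αN) P' X' →
          D.nCost (MFC.decentralized N α) P X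
            ≤ D.nCost (MFC.meanFieldFeedback N αN) P' X' + C / √(N : ℝ) + ε) ∧
        -- infimum over all feedback controls of time and the states of all agents
        (∀ β : ℝ → (Fin N → Fin d) → Fin N → A,
          (∀ x k, Measurable (fun t => β t x k)) →
          D.IsChain m₀ β P' X' →
          D.nCost (MFC.decentralized N α) P X ≤ D.nCost β P' X' + C / √(N : ℝ) + ε) := by
  obtain ⟨κ, hκ⟩ := hD.exists_boundedBy
  -- The rate is paid twice: once for the decentralized control, once for the competitor.
  refine ⟨D.rateConst κ + D.rateConst κ, fun m₀ hm₀ N hN ε _ α hα Ω _ P _ X hX Ω' _ P' _ X' => ?_⟩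
  obtain ⟨hαm, μ, hμ, hopt⟩ := hα
  have main : ∀ β : ℝ → (Fin N → Fin d) → Fin N → A,
      (∀ x k, Measurable (fun t => β t x k)) → D.IsChain m₀ β P' X' →
      D.nCost (MFC.decentralized N α) P X
        ≤ D.nCost β P' X' + (D.rateConst κ + D.rateConst κ) / √(N : ℝ) + ε := by
    intro β hβ hX'
    have h₁ := hX.nCost_decentralized_le hD hN hκ hm₀ hαm hμ
    -- By `ε`-optimality, `J(α) - ε` is a lower bound for all mean field costs.
    have h₂ := hX'.le_nCost hD hN hκ hm₀ hβ (V := D.mfCost α μ - ε)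
      fun a ν ha hν => by linarith [hopt a ν ha hν]
    rw [add_div]
    linarith
  exact ⟨fun αN hαN hX' => main _ (fun x k => hαN (x k) x) hX', main⟩
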